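/- Let $H$ be an infinite-dimensional complex Hilbert space with scalar product $\langle\cdot,\cdot\rangle$ (linear in the first argument), and let $A$ be a self-adjoint operator in $H$ whose spectrum consists of simple real eigenvalues $\lambda_n$, $n\in I$ (listed without repetition, with $I=\mathbb N$ or $I=\mathbb Z$, or any other index set), which are separated: $\inf_{m\ne n}|\lambda_m-\lambda_n|>0$. For each $n$ let $v_n$ be a normalized eigenvector of $A$ for the eigenvalue $\lambda_n$. For $\varphi,\psi\in H$ let $B=A+\langle\cdot,\varphi\rangle\psi$ on $\operatorname{dom}(B)=\operatorname{dom}(A)$, and write $a_n=\langle\varphi,v_n\rangle$, $b_n=\langle\psi,v_n\rangle$. We say that the spectrum of $B$ coincides with a family $(\nu_n)_{n\in I}$ counting multiplicities if $\sigma(B)=\{\nu_n : n\in I\}$ and if for every $\mu\in\mathbb C$ the root subspace $\{y : (B-\mu)^k y=0 \text{ for some } k\}$ has finite dimension, equal to the number of indices $n$ with $\nu_n=\mu$. Let $(\nu_n)_{n\in I}$ be complex numbers with $\sum_{n\in I}|\nu_n-\lambda_n|<\infty$. Then there are non-zero vectors $\varphi,\psi\in H$ such that the spectrum of $B=A+\langle\cdot,\varphi\rangle\psi$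 coincides with $(\nu_n)_{n\in I}$ counting multiplicities. Moreover, such vectors are obtained as follows. The product $$\tilde F(z)=\prod_{n\in I}\frac{\nu_n-z}{\lambda_n-z}$$ converges (unconditionally) for every $z\in\mathbb C\setminus\{\lambda_n : n\in I\}$, and the limits $-c_n:=\lim_{z\to\lambda_n}(z-\lambda_n)\tilde F(z)$ exist for all $n\in I$. There are non-zero vectors $\varphi,\psi\in H$ with $\overline{a_n}\,b_n=c_n$ for all $n\in I$; and for all $\varphi,\psi\in H$ with $\overline{a_n}\,b_n=c_n$ for all $n\in I$, the spectrum of $B$ coincides with $(\nu_n)_{n\in I}$ counting multiplicities. -/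

import Mathlib

open Filter Topology

namespace RankOne

noncomputable section

variable {H : Type*} [NormedAddCommGroup H] [InnerProductSpace ℂ H]

/-- The operator `T - z`, as a linear map on the domain of `T`. -/
def shift (T : H →ₗ.[ℂ] H) (z : ℂ) : T.domain →ₗ[ℂ] H :=
  T.toFun - z • T.domain.subtype

@[simp]
theorem shift_apply (T : H →ₗ.[ℂ] H) (z : ℂ) (x : T.domain) :
    shift T z x = T x - z • (x : H) := rfl

/-- The resolvent set: all `z` such that `T - z : dom T → H` has a bounded everywhere defined
two-sided inverse `R`. -/
def resolventSet (T : H →ₗ.[ℂ] H) : Set ℂ :=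
  {z | ∃ R : H →L[ℂ] H,
    (∀ y : H, ∃ h : R y ∈ T.domain, shift T z ⟨R y, h⟩ = y) ∧
    ∀ x : T.domain, R (shift T z x) = x}

/-- The spectrum of a (possibly unbounded) operator. -/
def spectrum (T : H →ₗ.[ℂ] H) : Set ℂ := (resolventSet T)ᶜ

/-- The null space of `(T - z) ^ k`, on its natural domain: `y` belongs to the null space of
`(T - z) ^ (k + 1)` iff `y ∈ dom T` and `(T - z) y` belongs to the null space of `(T - z) ^ k`. -/
def kerPow (T : H →ₗ.[ℂ] H) (z : ℂ) : ℕ → Submodule ℂ H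
  | 0 => ⊥
  | k + 1 => ((kerPow T z k).comap (shift T z)).map T.domain.subtype

theorem mem_kerPow_succ (T : H →ₗ.[ℂ] H) (z : ℂ) (k : ℕ) (y : H) :
    y ∈ kerPow T z (k + 1) ↔ ∃ h : y ∈ T.domain, shift T z ⟨y, h⟩ ∈ kerPow T z k := by
  simp [kerPow]

theorem kerPow_mono (T : H →ₗ.[ℂ] H) (z : ℂ) : Monotone (kerPow T z) := by
  refine monotone_nat_of_le_succ fun k => ?_
  induction k with
  | zero => exact bot_le
  | succ k ih => exact Submodule.map_mono (Submodule.comap_mono ih)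

/-- The eigenspace, i.e. the null space of `T - z`. -/
def eigenspace (T : H →ₗ.[ℂ] H) (z : ℂ) : Submodule ℂ H := kerPow T z 1

theorem mem_eigenspace (T : H →ₗ.[ℂ] H) (z : ℂ) (y : H) :
    y ∈ eigenspace T z ↔ ∃ h : y ∈ T.domain, T ⟨y, h⟩ = z • y := by
  rw [eigenspace, mem_kerPow_succ]
  simp [kerPow, sub_eq_zero]

/-- The root subspace: all `y` with `(T - z) ^ k y = 0` for some `k`. Its dimension is the
algebraic multiplicity of `z`. -/
def rootSubspace (T : H →ₗ.[ℂ] H) (z : ℂ) : Submodule ℂ H := ⨆ k, kerPow T z k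

theorem mem_rootSubspace (T : H →ₗ.[ℂ] H) (z : ℂ) (y : H) :
    y ∈ rootSubspace T z ↔ ∃ k, y ∈ kerPow T z k :=
  Submodule.mem_iSup_of_directed _ (kerPow_mono T z).directed_le

/-- The spectrum of `T` is the family `ν`, counting multiplicities: as a set, the spectrum is
the range of `ν`, and every `z` has finite algebraic multiplicity, equal to the number of indices
`n` with `ν n = z`. -/
def SpectrumIs {ι : Type*} (T : H →ₗ.[ℂ] H) (ν : ι → ℂ) : Prop :=
  spectrum T = Set.range ν ∧
  ∀ z : ℂ, {n | ν n = z}.Finite ∧ Module.Finite ℂ (rootSubspace T z) ∧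
    Module.finrank ℂ (rootSubspace T z) = {n | ν n = z}.ncard

/-- The self-adjoint operator `A` has simple discrete spectrum, consisting of the distinct
simple eigenvalues `lam n`, which are separated. -/
structure HasSimpleSeparatedSpectrum {ι : Type*} [CompleteSpace H] (A : H →ₗ.[ℂ] H)
    (lam : ι → ℝ) : Prop where
  selfAdjoint : IsSelfAdjoint A
  spectrum_eq : spectrum A = Set.range fun n => (lam n : ℂ)
  simple : ∀ n, Module.finrank ℂ (eigenspace A (lam n)) = 1
  separated : ∃ d : ℝ, 0 < d ∧ ∀ m n, m ≠ n → d ≤ |lam m - lam n|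

/-- The operator `A + ⟨·, φ⟩ ψ` on the domain of `A`. The scalar product `⟨y, φ⟩` is linear in
`y`; in Mathlib, whose inner product is linear in the second slot, it is `inner ℂ φ y`. -/
def perturb (A : H →ₗ.[ℂ] H) (φ ψ : H) : H →ₗ.[ℂ] H where
  domain := A.domain
  toFun := A.toFun + ((innerₛₗ ℂ φ).smulRight ψ).comp A.domain.subtype

theorem perturb_apply (A : H →ₗ.[ℂ] H) (φ ψ : H) (x : A.domain) :
    (perturb A φ ψ) x = A x + inner ℂ φ (x : H) • ψ := rfl

/-- The `n`-th Fourier coefficient `⟨x, v n⟩`, linear in `x`. -/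
def coeff {ι : Type*} (v : ι → H) (x : H) (n : ι) : ℂ := inner ℂ (v n) x

/-- The meromorphic function `∏ (ν n - z) / (lam n - z)`. -/
def quotProd {ι : Type*} (lam : ι → ℝ) (ν : ι → ℂ) (z : ℂ) : ℂ :=
  ∏' n, (ν n - z) / ((lam n : ℂ) - z)

end

end RankOne

/-!
Let `b` be the orthonormal family of eigenvectors `v`.  It is a Hilbert basis
(`RankOne.eq_zero_of_inner_eigenvectors_eq_zero`): at a real point `z` outside the spectrum, the
resolvent `R` of `A` is a bounded self-adjoint operator whose non-zero spectral points
`1 / (lam n - z)` are isolated, so their indicator functions are continuous on the spectrum of `R`,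
and the continuous functional calculus turns them into projections to eigenspaces of `A`. Finitely
many of these approximate `R` in norm, so that a vector orthogonal to all eigenvectors is
annihilated by `R`. Hence `A` is the maximal diagonal operator with entries `lam n`
(`RankOne.IsDiagonal`).

The infinite product has a partial fraction expansion `1 + ∑ c n / (lam n - z)` with `∑ |c n| < ∞`
(`RankOne.quotProd_eq`): this is Lagrange interpolation for the finite products, and dominated
convergence for series gives the limit. Since `(A - z)⁻¹` is diagonal, the expansion says that
the product equals `F z = 1 + ⟨(A - z)⁻¹ ψ, φ⟩` as soon as the coefficients of `φ` and `ψ` satisfy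
`conj (a n) * b n = c n`. On the other hand, the factors of the product show its order at every
point `μ`: the number of `n` with `ν n = μ`, minus one if `μ` is an eigenvalue of `A`
(`RankOne.exists_quotProd_mul_eq`).

It remains to read off multiplicities from orders. If `A₀ - μ` has a bounded inverse `R`, then the
root subspace at `μ` of `A₀ + ⟨·, φ⟩ ψ` is spanned by the Jordan chain `R ψ, …, R ^ p ψ`, where `p`
is the order of the zero of `1 + ⟨(A₀ - z)⁻¹ ψ, φ⟩` at `μ`, and for `p = 0` the perturbed operator
is invertible as well (`RankOne.finrank_rootSubspace_perturb`). If `μ` is not an eigenvalue of `A`,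
this applies with `A₀ = A`. If `μ = lam k`, the operator `A` is not invertible at `μ`, and the
perturbation is split differently. For `⟨φ, b k⟩ ≠ 0` one takes `A₀ = A + ⟨·, φ⟩ b k` and perturbs it by
`⟨·, φ⟩ (ψ - b k)`; for `⟨ψ, b k⟩ ≠ 0` one takes `A₀ = A + ⟨·, b k⟩ ψ`, symmetrically. In both cases
the relevant function is `F z * (lam k - z)` divided by a function without zero at `lam k`. If both
coefficients vanish, `b k` is an eigenvector which splits off, contributing one to the multiplicity,
and `A₀ = A + ⟨·, b k⟩ b k` handles the rest.
-/

/-! ### Separated sequences -/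

namespace RankOne

theorem exists_pos_le_norm_sub {ι : Type*} {lam : ι → ℝ} {d : ℝ} (hd : 0 < d)
    (hs : ∀ m n, m ≠ n → d ≤ |lam m - lam n|) (z : ℂ) :
    ∃ δ : ℝ, 0 < δ ∧ ∀ n, (lam n : ℂ) ≠ z → δ ≤ ‖(lam n : ℂ) - z‖ := by
  -- By separation, at most one `lam k` has distance less than `d / 2` from `z`.
  by_cases h : ∃ k, (lam k : ℂ) ≠ z ∧ ‖(lam k : ℂ) - z‖ < d / 2
  · obtain ⟨k, hk, hkd⟩ := h
    refine ⟨min (d / 2) ‖(lam k : ℂ) - z‖, lt_min (by positivity)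
      (norm_pos_iff.2 (sub_ne_zero.2 hk)), fun n _ => ?_⟩
    rcases eq_or_ne n k with rfl | hnk
    · exact min_le_right _ _
    · refine (min_le_left _ _).trans ?_
      have h1 := hs n k hnk
      have h2 : |lam n - lam k| ≤ ‖(lam n : ℂ) - z‖ + ‖(lam k : ℂ) - z‖ := by
        calc |lam n - lam k| = ‖((lam n : ℂ) - z) - ((lam k : ℂ) - z)‖ := by
              rw [sub_sub_sub_cancel_right, ← Complex.ofReal_sub, Complex.norm_real,
                Real.norm_eq_abs]
          _ ≤ _ := norm_sub_le _ _
      linarith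
  · push Not at h
    exact ⟨d / 2, by positivity, fun n hn => h n hn⟩

theorem eventually_half_le_norm_sub {ι : Type*} {lam : ι → ℝ} {δ : ℝ} (hδ : 0 < δ) {μ : ℂ}
    (h : ∀ n, (lam n : ℂ) ≠ μ → δ ≤ ‖(lam n : ℂ) - μ‖) :
    ∀ᶠ z in 𝓝[≠] μ, z ≠ μ ∧ ‖z - μ‖ < δ / 2 ∧ (∀ n, (lam n : ℂ) ≠ μ → δ / 2 ≤ ‖(lam n : ℂ) - z‖) ∧
      ∀ n, z ≠ (lam n : ℂ) := by
  have h1 : ∀ᶠ z in 𝓝[≠] μ, ‖z - μ‖ < δ / 2 := by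
    refine eventually_nhdsWithin_of_eventually_nhds ?_
    filter_upwards [Metric.ball_mem_nhds μ (half_pos hδ)] with z hz
    rwa [Metric.mem_ball, dist_eq_norm] at hz
  filter_upwards [h1, self_mem_nhdsWithin] with z hz hne
  have key : ∀ n, (lam n : ℂ) ≠ μ → δ / 2 ≤ ‖(lam n : ℂ) - z‖ := by
    intro n hn
    have h2 := h n hn
    have h3 : ‖(lam n : ℂ) - μ‖ ≤ ‖(lam n : ℂ) - z‖ + ‖z - μ‖ := by
      simpa using norm_add_le ((lam n : ℂ) - z) (z - μ)
    linarith
  refine ⟨hne, hz, key, fun n hzn => ?_⟩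
  by_cases hn : (lam n : ℂ) = μ
  · exact hne (hzn.trans hn)
  · have := key n hn
    rw [hzn, sub_self, norm_zero] at this
    linarith

theorem injective_of_separated {ι : Type*} {lam : ι → ℝ} {d : ℝ} (hd : 0 < d)
    (hs : ∀ m n, m ≠ n → d ≤ |lam m - lam n|) : Function.Injective lam := by
  intro m n h
  by_contra hmn
  have := hs m n hmn
  rw [h, sub_self, abs_zero] at this
  linarith

theorem finite_abs_le_of_separated {ι : Type*} {lam : ι → ℝ} {d : ℝ} (hd : 0 < d)
    (hs : ∀ m n, m ≠ n → d ≤ |lam m - lam n|) (C : ℝ) : {n | |lam n| ≤ C}.Finite := by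
  have hinj : Set.InjOn (fun n => ⌊lam n / d⌋) {n | |lam n| ≤ C} := by
    intro m _ n _ h
    by_contra hmn
    have h1 := Int.abs_sub_lt_one_of_floor_eq_floor h
    rw [← sub_div, abs_div, abs_of_pos hd, div_lt_one hd] at h1
    exact absurd (hs m n hmn) (not_le.2 h1)
  refine Set.Finite.of_finite_image ((Set.finite_Icc ⌊-C / d⌋ ⌊C / d⌋).subset ?_) hinj
  rintro _ ⟨n, hn, rfl⟩
  have hn' := abs_le.1 (show |lam n| ≤ C from by simpa using hn)
  refine ⟨Int.floor_le_floor ?_, Int.floor_le_floor ?_⟩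
  · exact div_le_div_of_nonneg_right hn'.1 hd.le
  · exact div_le_div_of_nonneg_right hn'.2 hd.le

theorem finite_fiber {ι : Type*} {lam : ι → ℝ} {d : ℝ} (hd : 0 < d)
    (hs : ∀ m n, m ≠ n → d ≤ |lam m - lam n|) {ν : ι → ℂ}
    (hν : Summable fun n => ‖ν n - (lam n : ℂ)‖) (z : ℂ) : {n | ν n = z}.Finite := by
  have h1 : {n | ¬ ‖ν n - (lam n : ℂ)‖ < 1}.Finite :=
    hν.tendsto_cofinite_zero.eventually (gt_mem_nhds one_pos)
  refine (h1.union (finite_abs_le_of_separated hd hs (‖z‖ + 1))).subset ?_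
  intro n hn
  by_cases h : ‖ν n - (lam n : ℂ)‖ < 1
  · right
    have hn' : ν n = z := hn
    rw [hn'] at h
    have : ‖(lam n : ℂ)‖ ≤ ‖z‖ + ‖z - (lam n : ℂ)‖ := by
      simpa using norm_sub_le z (z - (lam n : ℂ))
    rw [Complex.norm_real, Real.norm_eq_abs] at this
    exact this.trans (by linarith)
  · exact Or.inl h

/-! ### The infinite product and its partial fraction expansion -/

/-- Partial fraction expansion of `∏ (y i - z) / (x i - z)`, with distinct nodes `x i`. -/
theorem prod_div_eq_one_add_sum {ι 𝕜 : Type*} [DecidableEq ι] [Field 𝕜] (s : Finset ι)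
    {x : ι → 𝕜} (y : ι → 𝕜) (hx : Set.InjOn x s) {z : 𝕜} (hz : ∀ i ∈ s, z ≠ x i) :
    ∏ i ∈ s, (y i - z) / (x i - z) =
      1 + ∑ i ∈ s, (y i - x i) * (∏ j ∈ s.erase i, (y j - x i) / (x j - x i)) / (x i - z) := by
  rcases s.eq_empty_or_nonempty with rfl | hne
  · simp
  have hdeg : (Lagrange.nodal s y - Lagrange.nodal s x).degree < s.card := by
    rw [← Lagrange.degree_nodal (R := 𝕜) (s := s) (v := y)]
    refine Polynomial.degree_sub_lt_left ?_ Lagrange.nodal_ne_zero ?_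
    · rw [Lagrange.degree_nodal, Lagrange.degree_nodal]
    · rw [Lagrange.nodal_monic.leadingCoeff, Lagrange.nodal_monic.leadingCoeff]
  have h1 := congrArg (Polynomial.eval z) (Lagrange.eq_interpolate hx hdeg)
  rw [Lagrange.eval_interpolate_not_at_node _ hz, Polynomial.eval_sub, Lagrange.eval_nodal,
    Lagrange.eval_nodal] at h1
  have h2 : ∏ i ∈ s, (z - x i) ≠ 0 := Finset.prod_ne_zero_iff.2 fun i hi => sub_ne_zero.2 (hz i hi)
  have h3 : ∏ i ∈ s, (y i - z) / (x i - z) = (∏ i ∈ s, (z - y i)) / ∏ i ∈ s, (z - x i) := by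
    rw [← Finset.prod_div_distrib]
    refine Finset.prod_congr rfl fun i _ => ?_
    rw [← neg_sub z, ← neg_sub z, neg_div_neg_eq]
  rw [h3, sub_eq_iff_eq_add.1 h1, add_div, div_self h2, add_comm, mul_div_cancel_left₀ _ h2]
  congr 1
  refine Finset.sum_congr rfl fun i hi => ?_
  rw [Polynomial.eval_sub, Lagrange.eval_nodal_at_node hi, sub_zero, Lagrange.eval_nodal,
    Lagrange.nodalWeight, ← Finset.mul_prod_erase s _ hi, Finset.prod_div_distrib,
    Finset.prod_inv_distrib, ← neg_sub z (x i), ← neg_sub (x i) (y i)]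
  have h4 : (∏ j ∈ s.erase i, (y j - x i)) / ∏ j ∈ s.erase i, (x j - x i) =
      (∏ j ∈ s.erase i, (x i - y j)) / ∏ j ∈ s.erase i, (x i - x j) := by
    rw [← Finset.prod_div_distrib, ← Finset.prod_div_distrib]
    refine Finset.prod_congr rfl fun j _ => ?_
    rw [← neg_sub (x i), ← neg_sub (x i), neg_div_neg_eq]
  rw [h4, neg_mul, neg_div_neg_eq]
  simp only [div_eq_mul_inv]
  ring

noncomputable section

open Classical in
/-- The factor of index `m` in the value at `lam n` of the product without its `n`-th factor,
which is replaced by `1`. -/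
def deletedFactor {ι : Type*} (lam : ι → ℝ) (ν : ι → ℂ) (n m : ι) : ℂ :=
  if m = n then 1 else (ν m - (lam n : ℂ)) / ((lam m : ℂ) - (lam n : ℂ))

/-- The coefficient of `1 / (lam n - z)` in the partial fraction expansion of
`RankOne.quotProd`, that is, minus the residue at `lam n`. -/
def resCoeff {ι : Type*} (lam : ι → ℝ) (ν : ι → ℂ) (n : ι) : ℂ :=
  (ν n - (lam n : ℂ)) * ∏' m, deletedFactor lam ν n m

end

section Product

variable {ι : Type*} {lam : ι → ℝ} {d : ℝ} (hd : 0 < d)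
  (hs : ∀ m n, m ≠ n → d ≤ |lam m - lam n|) {ν : ι → ℂ}
  (hν : Summable fun n => ‖ν n - (lam n : ℂ)‖)

theorem div_eq_one_add {a b z : ℂ} (h : z ≠ b) : (a - z) / (b - z) = 1 + (a - b) / (b - z) := by
  have : b - z ≠ 0 := sub_ne_zero.2 h.symm
  field_simp
  ring

include hd hs

theorem norm_deletedFactor_sub_one_le (ν : ι → ℂ) (n m : ι) :
    ‖deletedFactor lam ν n m - 1‖ ≤ ‖ν m - (lam m : ℂ)‖ / d := by
  unfold deletedFactor
  split_ifs with h
  · simp only [sub_self, norm_zero]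
    positivity
  · have hne : (lam n : ℂ) ≠ (lam m : ℂ) := by
      intro h'
      exact h (injective_of_separated hd hs (Complex.ofReal_injective h')).symm
    rw [div_eq_one_add hne, add_sub_cancel_left, norm_div, ← Complex.ofReal_sub,
      Complex.norm_real, Real.norm_eq_abs]
    exact div_le_div_of_nonneg_left (norm_nonneg _) hd (hs m n h)

include hν

theorem summable_norm_div {z : ℂ} (hz : ∀ n, z ≠ (lam n : ℂ)) :
    Summable fun n => ‖(ν n - (lam n : ℂ)) / ((lam n : ℂ) - z)‖ := by
  obtain ⟨δ, hδ, h⟩ := exists_pos_le_norm_sub hd hs z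
  refine Summable.of_nonneg_of_le (fun _ => norm_nonneg _) (fun n => ?_) (hν.div_const δ)
  rw [norm_div]
  exact div_le_div_of_nonneg_left (norm_nonneg _) hδ (h n (hz n).symm)

theorem multipliable_quot {z : ℂ} (hz : ∀ n, z ≠ (lam n : ℂ)) :
    Multipliable fun n => (ν n - z) / ((lam n : ℂ) - z) := by
  simp_rw [fun n => div_eq_one_add (a := ν n) (hz n)]
  exact multipliable_one_add_of_summable (summable_norm_div hd hs hν hz)

theorem multipliable_deletedFactor (n : ι) : Multipliable (deletedFactor lam ν n) := by
  have : deletedFactor lam ν n = fun m => 1 + (deletedFactor lam ν n m - 1) := by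
    funext m; ring
  rw [this]
  refine multipliable_one_add_of_summable ?_
  exact Summable.of_nonneg_of_le (fun _ => norm_nonneg _)
    (norm_deletedFactor_sub_one_le hd hs ν n) (hν.div_const d)

theorem norm_prod_deletedFactor_le (n : ι) (s : Finset ι) :
    ‖∏ m ∈ s, deletedFactor lam ν n m‖ ≤ Real.exp (∑' m, ‖ν m - (lam m : ℂ)‖ / d) := by
  rw [norm_prod]
  calc ∏ m ∈ s, ‖deletedFactor lam ν n m‖
      ≤ ∏ m ∈ s, (1 + ‖ν m - (lam m : ℂ)‖ / d) := by
        refine Finset.prod_le_prod (fun _ _ => norm_nonneg _) fun m _ => ?_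
        have h1 := norm_deletedFactor_sub_one_le hd hs ν n m
        have h2 : ‖deletedFactor lam ν n m‖ ≤ 1 + ‖deletedFactor lam ν n m - 1‖ := by
          simpa using norm_add_le 1 (deletedFactor lam ν n m - 1)
        linarith
    _ ≤ Real.exp (∑ m ∈ s, ‖ν m - (lam m : ℂ)‖ / d) :=
        Real.prod_one_add_le_exp_sum _ fun _ => by positivity
    _ ≤ _ := Real.exp_le_exp.2 <|
        (hν.div_const d).sum_le_tsum s fun _ _ => by positivity

theorem norm_resCoeff_le (n : ι) :
    ‖resCoeff lam ν n‖ ≤ ‖ν n - (lam n : ℂ)‖ * Real.exp (∑' m, ‖ν m - (lam m : ℂ)‖ / d) := by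
  rw [resCoeff, norm_mul]
  refine mul_le_mul_of_nonneg_left ?_ (norm_nonneg _)
  exact le_of_tendsto (multipliable_deletedFactor hd hs hν n).hasProd.norm
    (Eventually.of_forall fun s => by
      rw [← norm_prod]; exact norm_prod_deletedFactor_le hd hs hν n s)

theorem summable_norm_resCoeff : Summable fun n => ‖resCoeff lam ν n‖ :=
  Summable.of_nonneg_of_le (fun _ => norm_nonneg _) (norm_resCoeff_le hd hs hν)
    (hν.mul_right _)

/-- The partial fraction expansion of the infinite product. It is the limit of the expansions of
the finite products, by dominated convergence for series. -/
theorem quotProd_eq {z : ℂ} (hz : ∀ n, z ≠ (lam n : ℂ)) :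
    quotProd lam ν z = 1 + ∑' n, resCoeff lam ν n / ((lam n : ℂ) - z) := by
  classical
  obtain ⟨δ, hδ, hle⟩ := exists_pos_le_norm_sub hd hs z
  set f : Finset ι → ι → ℂ := fun s n => if n ∈ s then
    (ν n - (lam n : ℂ)) * (∏ m ∈ s, deletedFactor lam ν n m) / ((lam n : ℂ) - z) else 0 with hf
  have hfin : ∀ s : Finset ι, ∏ n ∈ s, (ν n - z) / ((lam n : ℂ) - z) = 1 + ∑' n, f s n := by
    intro s
    rw [prod_div_eq_one_add_sum (x := fun n => (lam n : ℂ)) s ν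
      ((Complex.ofReal_injective.comp (injective_of_separated hd hs)).injOn) fun n _ => hz n,
      tsum_eq_sum (s := s) fun n hn => if_neg hn]
    congr 1
    refine Finset.sum_congr rfl fun n hn => ?_
    simp only [if_pos hn]
    rw [← Finset.mul_prod_erase s (deletedFactor lam ν n) hn]
    congr 2
    rw [deletedFactor, if_pos rfl, one_mul]
    refine Finset.prod_congr rfl fun m hm => ?_
    rw [deletedFactor, if_neg (Finset.ne_of_mem_erase hm)]
  set C := Real.exp (∑' m, ‖ν m - (lam m : ℂ)‖ / d) with hC
  have hlim : Tendsto (fun s => ∑' n, f s n) atTop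
      (𝓝 (∑' n, resCoeff lam ν n / ((lam n : ℂ) - z))) := by
    refine tendsto_tsum_of_dominated_convergence
      (bound := fun n => ‖ν n - (lam n : ℂ)‖ * C / δ) ((hν.mul_right C).div_const δ)
      (fun n => ?_) (Eventually.of_forall fun s n => ?_)
    · have h1 : Tendsto (fun s : Finset ι => (ν n - (lam n : ℂ)) *
          (∏ m ∈ s, deletedFactor lam ν n m) / ((lam n : ℂ) - z)) atTop
          (𝓝 (resCoeff lam ν n / ((lam n : ℂ) - z))) :=
        ((multipliable_deletedFactor hd hs hν n).hasProd.const_mul _).div_const _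
      refine h1.congr' ?_
      filter_upwards [eventually_ge_atTop {n}] with s hs'
      simp only [hf, if_pos (Finset.singleton_subset_iff.1 hs')]
    · simp only [hf]
      split_ifs
      · rw [norm_div, norm_mul]
        have h1 := norm_prod_deletedFactor_le hd hs hν n s
        have h2 := hle n (hz n).symm
        gcongr
      · rw [norm_zero]
        positivity
  have h1 : Tendsto (fun s : Finset ι => ∏ n ∈ s, (ν n - z) / ((lam n : ℂ) - z)) atTop
      (𝓝 (quotProd lam ν z)) := (multipliable_quot hd hs hν hz).hasProd
  simp_rw [hfin] at h1
  exact tendsto_nhds_unique h1 (hlim.const_add 1)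

theorem tendsto_mul_quotProd (n : ι) :
    Tendsto (fun z : ℂ => (z - (lam n : ℂ)) * quotProd lam ν z)
      (𝓝[≠] (lam n : ℂ)) (𝓝 (-resCoeff lam ν n)) := by
  classical
  obtain ⟨δ, hδ, hle⟩ := exists_pos_le_norm_sub hd hs (lam n : ℂ)
  have hev := eventually_half_le_norm_sub hδ hle
  have hz0 : Tendsto (fun z : ℂ => z - (lam n : ℂ)) (𝓝[≠] (lam n : ℂ)) (𝓝 0) := by
    have : Tendsto (fun z : ℂ => z - (lam n : ℂ)) (𝓝 (lam n : ℂ)) (𝓝 ((lam n : ℂ) - lam n)) :=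
      tendsto_id.sub_const _
    rw [sub_self] at this
    exact this.mono_left nhdsWithin_le_nhds
  have hsum : Tendsto (fun z : ℂ => ∑' m, (z - (lam n : ℂ)) *
      (resCoeff lam ν m / ((lam m : ℂ) - z))) (𝓝[≠] (lam n : ℂ))
      (𝓝 (∑' m, if m = n then -resCoeff lam ν n else 0)) := by
    refine tendsto_tsum_of_dominated_convergence (summable_norm_resCoeff hd hs hν) (fun m => ?_) ?_
    · split_ifs with h
      · subst h
        refine tendsto_const_nhds.congr' ?_
        filter_upwards [hev] with z hz
        have : (lam m : ℂ) - z ≠ 0 := sub_ne_zero.2 (hz.2.2.2 m).symm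
        field_simp
        ring
      · have hne : (lam m : ℂ) - lam n ≠ 0 := by
          rw [sub_ne_zero]
          exact fun h' => h (injective_of_separated hd hs (Complex.ofReal_injective h'))
        have h1 : Tendsto (fun z : ℂ => (lam m : ℂ) - z) (𝓝[≠] (lam n : ℂ))
            (𝓝 ((lam m : ℂ) - lam n)) :=
          (tendsto_id.const_sub _).mono_left nhdsWithin_le_nhds
        simpa using hz0.mul ((tendsto_const_nhds (x := resCoeff lam ν m)).div h1 hne)
    · filter_upwards [hev] with z hz m
      rw [norm_mul, norm_div, ← mul_div_assoc, mul_comm, mul_div_assoc]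
      refine mul_le_of_le_one_right (norm_nonneg _) ?_
      have h0 : 0 < ‖(lam m : ℂ) - z‖ := norm_pos_iff.2 (sub_ne_zero.2 (hz.2.2.2 m).symm)
      rw [div_le_one h0]
      rcases eq_or_ne (lam m : ℂ) (lam n : ℂ) with h | h
      · rw [h, norm_sub_rev]
      · exact hz.2.1.le.trans (hz.2.2.1 m h)
  rw [tsum_ite_eq] at hsum
  have := hz0.add hsum
  rw [zero_add] at this
  refine this.congr' ?_
  filter_upwards [hev] with z hz
  rw [quotProd_eq hd hs hν hz.2.2.2, tsum_mul_left]
  ring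

/-- If `ν n = lam n` whenever one of the two is `μ`, then the product has a non-zero limit
at `μ`. -/
theorem exists_tendsto_quotProd_ne_zero {μ : ℂ} (h1 : ∀ n, ν n = μ → ν n = lam n)
    (h2 : ∀ n, (lam n : ℂ) = μ → ν n = lam n) :
    ∃ l ≠ 0, Tendsto (quotProd lam ν) (𝓝[≠] μ) (𝓝 l) := by
  classical
  obtain ⟨δ, hδ, hle⟩ := exists_pos_le_norm_sub hd hs μ
  have hev := eventually_half_le_norm_sub hδ hle
  have hbd : Summable fun n => ‖ν n - (lam n : ℂ)‖ / (δ / 2) := hν.div_const _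
  -- For `lam n = μ` the factor is constantly `1`, so here the term `0 / 0 = 0` is the right limit.
  refine ⟨∏' n, (1 + (ν n - (lam n : ℂ)) / ((lam n : ℂ) - μ)), ?_, ?_⟩
  · refine tprod_one_add_ne_zero_of_summable (fun n => ?_) ?_
    · by_cases hn : (lam n : ℂ) = μ
      · rw [h2 n hn, sub_self, zero_div, add_zero]
        exact one_ne_zero
      · rw [← div_eq_one_add (Ne.symm hn)]
        refine div_ne_zero (sub_ne_zero.2 fun h => ?_) (sub_ne_zero.2 hn)
        exact hn ((h1 n h).symm.trans h)
    · refine Summable.of_nonneg_of_le (fun _ => norm_nonneg _) (fun n => ?_) (hν.div_const δ)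
      rw [norm_div]
      by_cases hn : (lam n : ℂ) = μ
      · rw [hn, sub_self, norm_zero, div_zero]
        positivity
      · exact div_le_div_of_nonneg_left (norm_nonneg _) hδ (hle n hn)
  · have hlim : Tendsto (fun z : ℂ => ∏' n, (1 + (ν n - (lam n : ℂ)) / ((lam n : ℂ) - z)))
        (𝓝[≠] μ) (𝓝 (∏' n, (1 + (ν n - (lam n : ℂ)) / ((lam n : ℂ) - μ)))) := by
      refine tendsto_tprod_one_add_of_dominated_convergence hbd (fun n => ?_) ?_
      · by_cases hn : (lam n : ℂ) = μ
        · simp only [h2 n hn, sub_self, zero_div]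
          exact tendsto_const_nhds
        · exact tendsto_const_nhds.div
            ((tendsto_id.const_sub _).mono_left nhdsWithin_le_nhds) (sub_ne_zero.2 hn)
      · filter_upwards [hev] with z hz n
        rw [norm_div]
        by_cases hn : (lam n : ℂ) = μ
        · rw [h2 n hn, sub_self, norm_zero, zero_div]
          positivity
        · exact div_le_div_of_nonneg_left (norm_nonneg _) (half_pos hδ) (hz.2.2.1 n hn)
    refine hlim.congr' ?_
    filter_upwards [hev] with z hz
    rw [quotProd]
    exact tprod_congr fun n => (div_eq_one_add (hz.2.2.2 n)).symm

/-- The order of the infinite product at `μ`: it is the number of indices `n` with `ν n = μ`,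
minus the number of indices `n` with `lam n = μ`. -/
theorem exists_quotProd_mul_eq (μ : ℂ) {K : Finset ι} (hK : ∀ n, (lam n : ℂ) = μ ↔ n ∈ K) :
    ∃ (h : ℂ → ℂ) (l : ℂ), l ≠ 0 ∧ Tendsto h (𝓝[≠] μ) (𝓝 l) ∧
      ∀ᶠ z in 𝓝[≠] μ, quotProd lam ν z * ∏ n ∈ K, ((lam n : ℂ) - z) =
        (z - μ) ^ {n | ν n = μ}.ncard * h z := by
  classical
  obtain ⟨δ, hδ, hle⟩ := exists_pos_le_norm_sub hd hs μ
  have hev := eventually_half_le_norm_sub hδ hle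
  have hfin := finite_fiber hd hs hν μ
  set Z := hfin.toFinset with hZ
  have hmemZ : ∀ n, n ∈ Z ↔ ν n = μ := fun n => by simp [hZ]
  set S := Z ∪ K with hS
  -- Moving the finitely many relevant `ν n` to `lam n` removes the zero and the pole at `μ`.
  set ν' : ι → ℂ := fun n => if n ∈ S then (lam n : ℂ) else ν n with hν'
  have hν's : Summable fun n => ‖ν' n - (lam n : ℂ)‖ := by
    refine Summable.of_nonneg_of_le (fun _ => norm_nonneg _) (fun n => ?_) hν
    rw [hν']
    dsimp only
    split_ifs
    · simp
    · exact le_rfl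
  obtain ⟨l, hl, hlim⟩ := exists_tendsto_quotProd_ne_zero hd hs hν's (μ := μ)
    (fun n hn => by
      by_cases h : n ∈ S
      · exact if_pos h
      · have h' : ν' n = ν n := if_neg h
        exact absurd (Finset.mem_union_left K ((hmemZ n).2 (h'.symm.trans hn))) h)
    (fun n hn => if_pos (Finset.mem_union_right _ ((hK n).1 hn)))
  refine ⟨fun z => (-1) ^ Z.card * (∏ n ∈ S \ Z, (ν n - z)) / (∏ n ∈ S \ K, ((lam n : ℂ) - z)) *
    quotProd lam ν' z, (-1) ^ Z.card * (∏ n ∈ S \ Z, (ν n - μ)) /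
      (∏ n ∈ S \ K, ((lam n : ℂ) - μ)) * l, ?_, ?_, ?_⟩
  · refine mul_ne_zero (div_ne_zero (mul_ne_zero (by simp) ?_) ?_) hl
    · exact Finset.prod_ne_zero_iff.2 fun n hn =>
        sub_ne_zero.2 fun h => (Finset.mem_sdiff.1 hn).2 ((hmemZ n).2 h)
    · exact Finset.prod_ne_zero_iff.2 fun n hn =>
        sub_ne_zero.2 fun h => (Finset.mem_sdiff.1 hn).2 ((hK n).1 h)
  · refine Tendsto.mul (Tendsto.div (Tendsto.const_mul _ ?_) ?_ ?_) hlim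
    · exact tendsto_finsetProd _ fun n _ =>
        (tendsto_id.const_sub _).mono_left nhdsWithin_le_nhds
    · exact tendsto_finsetProd _ fun n _ =>
        (tendsto_id.const_sub _).mono_left nhdsWithin_le_nhds
    · exact Finset.prod_ne_zero_iff.2 fun n hn =>
        sub_ne_zero.2 fun h => (Finset.mem_sdiff.1 hn).2 ((hK n).1 h)
  · filter_upwards [hev] with z hz
    have hne : ∀ n, (lam n : ℂ) - z ≠ 0 := fun n => sub_ne_zero.2 (hz.2.2.2 n).symm
    have hsplit : quotProd lam ν z =
        (∏ n ∈ S, (ν n - z) / ((lam n : ℂ) - z)) * quotProd lam ν' z := by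
      have h1 : ∏ n ∈ S, (ν n - z) / ((lam n : ℂ) - z) =
          ∏' n, if n ∈ S then (ν n - z) / ((lam n : ℂ) - z) else 1 := by
        rw [tprod_eq_prod (s := S) fun n hn => if_neg hn]
        exact Finset.prod_congr rfl fun n hn => (if_pos hn).symm
      have h2 : Multipliable fun n => if n ∈ S then (ν n - z) / ((lam n : ℂ) - z) else 1 :=
        multipliable_of_ne_finset_one (s := S) fun n hn => if_neg hn
      rw [h1, quotProd, quotProd, ← h2.tprod_mul (multipliable_quot hd hs hν's hz.2.2.2)]
      refine tprod_congr fun n => ?_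
      rw [hν']
      dsimp only
      split_ifs
      · rw [div_self (hne n), mul_one]
      · rw [one_mul]
    have hZc : ∏ n ∈ Z, (ν n - z) = (-1) ^ Z.card * (z - μ) ^ Z.card := by
      rw [← mul_pow, ← Finset.prod_const]
      refine Finset.prod_congr rfl fun n hn => ?_
      rw [(hmemZ n).1 hn]
      ring
    have hnum : ∏ n ∈ S, (ν n - z) =
        (∏ n ∈ S \ Z, (ν n - z)) * ((-1) ^ Z.card * (z - μ) ^ Z.card) := by
      rw [← hZc, Finset.prod_sdiff Finset.subset_union_left]
    have hden : ∏ n ∈ S, ((lam n : ℂ) - z) =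
        (∏ n ∈ S \ K, ((lam n : ℂ) - z)) * ∏ n ∈ K, ((lam n : ℂ) - z) :=
      (Finset.prod_sdiff Finset.subset_union_right).symm
    have hd1 : ∏ n ∈ S \ K, ((lam n : ℂ) - z) ≠ 0 := Finset.prod_ne_zero_iff.2 fun n _ => hne n
    have hd2 : ∏ n ∈ K, ((lam n : ℂ) - z) ≠ 0 := Finset.prod_ne_zero_iff.2 fun n _ => hne n
    rw [hsplit, Finset.prod_div_distrib, hnum, hden, Set.ncard_eq_toFinset_card _ hfin, ← hZ]
    field_simp

end Product

end RankOne

/-! ### Multiplicities for a perturbation of an operator that is invertible at the point -/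

namespace RankOne

section Multiplicity

variable {H : Type*} [NormedAddCommGroup H] [InnerProductSpace ℂ H]

theorem mem_perturb_domain {A : H →ₗ.[ℂ] H} {φ ψ x : H} :
    x ∈ (perturb A φ ψ).domain ↔ x ∈ A.domain := Iff.rfl

theorem shift_perturb_apply {A : H →ₗ.[ℂ] H} {φ ψ : H} {z : ℂ} {x : H}
    (h : x ∈ (perturb A φ ψ).domain) (hx : x ∈ A.domain) :
    shift (perturb A φ ψ) z ⟨x, h⟩ = shift A z ⟨x, hx⟩ + inner ℂ φ x • ψ :=
  add_sub_right_comm (A ⟨x, hx⟩) (inner ℂ φ x • ψ) (z • x)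

theorem rootSubspace_eq_bot_of_mem_resolventSet {T : H →ₗ.[ℂ] H} {z : ℂ}
    (hz : z ∈ resolventSet T) : rootSubspace T z = ⊥ := by
  obtain ⟨R, -, hR⟩ := hz
  refine iSup_eq_bot.2 fun k => ?_
  induction k with
  | zero => rfl
  | succ k ih =>
    refine (Submodule.eq_bot_iff _).2 fun y hy => ?_
    obtain ⟨hyd, hy⟩ := (mem_kerPow_succ T z k y).1 hy
    rw [ih, Submodule.mem_bot] at hy
    have := hR ⟨y, hyd⟩
    rwa [hy, map_zero, eq_comm] at this

/-- Comparison of coefficients in an expansion in powers of `z - μ`. -/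
theorem eq_zero_and_eq_of_expansion {μ l : ℂ} (p : ℕ) {g : ℕ → ℂ} {r h : ℂ → ℂ}
    (hr : Tendsto (fun z => (z - μ) * r z) (𝓝[≠] μ) (𝓝 0)) (hh : Tendsto h (𝓝[≠] μ) (𝓝 l))
    (heq : ∀ᶠ z in 𝓝[≠] μ, ∑ j ∈ Finset.range (p + 1), (z - μ) ^ j * g j +
      (z - μ) ^ (p + 1) * r z = (z - μ) ^ p * h z) :
    (∀ j < p, g j = 0) ∧ g p = l := by
  have hu : Tendsto (fun z : ℂ => z - μ) (𝓝[≠] μ) (𝓝 0) := by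
    have : Tendsto (fun z : ℂ => z - μ) (𝓝 μ) (𝓝 (μ - μ)) := tendsto_id.sub_const _
    rw [sub_self] at this
    exact this.mono_left nhdsWithin_le_nhds
  induction p generalizing g with
  | zero =>
    refine ⟨by simp, ?_⟩
    have h1 : Tendsto (fun z : ℂ => g 0 + (z - μ) * r z) (𝓝[≠] μ) (𝓝 (g 0 + 0)) := hr.const_add _
    rw [add_zero] at h1
    refine tendsto_nhds_unique h1 (hh.congr' ?_)
    filter_upwards [heq] with z hz
    simpa using hz.symm
  | succ p ih =>
    have h0 : g 0 = 0 := by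
      have h1 : Tendsto (fun z : ℂ => ∑ j ∈ Finset.range (p + 1), (z - μ) ^ (j + 1) * g (j + 1) +
          g 0 + (z - μ) ^ (p + 1) * ((z - μ) * r z)) (𝓝[≠] μ)
          (𝓝 (∑ j ∈ Finset.range (p + 1), 0 ^ (j + 1) * g (j + 1) + g 0 + 0 ^ (p + 1) * 0)) :=
        ((tendsto_finsetSum _ fun j _ => (hu.pow (j + 1)).mul_const _).add_const _).add
          ((hu.pow (p + 1)).mul hr)
      have h2 : Tendsto (fun z : ℂ => (z - μ) ^ (p + 1) * h z) (𝓝[≠] μ) (𝓝 (0 ^ (p + 1) * l)) :=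
        (hu.pow (p + 1)).mul hh
      have h3 := tendsto_nhds_unique h1 (h2.congr' ?_)
      · simpa using h3
      · filter_upwards [heq] with z hz
        rw [← hz, Finset.sum_range_succ' _ (p + 1)]
        ring
    obtain ⟨h1, h2⟩ := ih (g := fun j => g (j + 1)) (by
      filter_upwards [heq, self_mem_nhdsWithin] with z hz hne
      have hne' : z - μ ≠ 0 := sub_ne_zero.2 hne
      refine mul_left_cancel₀ hne' ?_
      rw [Finset.sum_range_succ' _ (p + 1), h0] at hz
      rw [mul_add, Finset.mul_sum]
      calc _ = ∑ j ∈ Finset.range (p + 1), (z - μ) ^ (j + 1) * g (j + 1) + (z - μ) ^ 0 * 0 +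
            (z - μ) ^ (p + 1 + 1) * r z := by
              rw [mul_zero, add_zero]
              congr 1
              · exact Finset.sum_congr rfl fun j _ => by ring
              · ring
        _ = _ := by rw [hz]; ring)
    refine ⟨fun j hj => ?_, h2⟩
    cases j with
    | zero => exact h0
    | succ j => exact h1 j (by omega)

variable {A : H →ₗ.[ℂ] H} {μ : ℂ} {R : H →L[ℂ] H}

theorem resolvent_injective (hR : ∀ y : H, ∃ h : R y ∈ A.domain, shift A μ ⟨R y, h⟩ = y) :
    Function.Injective R := by
  intro x y hxy
  obtain ⟨h1, h2⟩ := hR x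
  obtain ⟨h3, h4⟩ := hR y
  rw [← h2, ← h4]
  congr 1
  exact Subtype.ext hxy

/-- If `A - μ` is invertible with bounded inverse `R` and the Taylor coefficient
`1 + ⟨R ψ, φ⟩` does not vanish, then `A + ⟨·, φ⟩ ψ - μ` is invertible, with the
Sherman-Morrison formula for the inverse. -/
theorem mem_resolventSet_perturb (hR : ∀ y : H, ∃ h : R y ∈ A.domain, shift A μ ⟨R y, h⟩ = y)
    (hR' : ∀ x : A.domain, R (shift A μ x) = x) {φ ψ : H} (h0 : 1 + inner ℂ φ (R ψ) ≠ 0) :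
    μ ∈ resolventSet (perturb A φ ψ) := by
  refine ⟨R - (1 + inner ℂ φ (R ψ))⁻¹ • ((innerSL ℂ φ).comp R).smulRight (R ψ), fun y => ?_, ?_⟩
  · have happ : (R - (1 + inner ℂ φ (R ψ))⁻¹ • ((innerSL ℂ φ).comp R).smulRight (R ψ)) y =
        R (y - ((1 + inner ℂ φ (R ψ))⁻¹ * inner ℂ φ (R y)) • ψ) := by
      simp [mul_smul]
    obtain ⟨h1, h2⟩ := hR (y - ((1 + inner ℂ φ (R ψ))⁻¹ * inner ℂ φ (R y)) • ψ)
    rw [happ]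
    refine ⟨mem_perturb_domain.2 h1, ?_⟩
    rw [shift_perturb_apply _ h1, h2, map_sub, map_smul, inner_sub_right, inner_smul_right, sub_add,
      ← sub_smul]
    convert sub_zero y
    rw [smul_eq_zero]
    left
    field_simp
    ring
  · rintro ⟨x, hx⟩
    have hx1 := hR' ⟨x, mem_perturb_domain.1 hx⟩
    rw [shift_perturb_apply _ (mem_perturb_domain.1 hx)]
    simp only [sub_apply, smul_apply,
      ContinuousLinearMap.smulRight_apply, ContinuousLinearMap.comp_apply, innerSL_apply_apply,
      map_add, map_smul, hx1, smul_smul]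
    have h1 : inner ℂ φ x - (1 + inner ℂ φ (R ψ))⁻¹ * inner ℂ φ x -
        inner ℂ φ x * ((1 + inner ℂ φ (R ψ))⁻¹ * inner ℂ φ (R ψ)) = 0 := by
      field_simp
      ring
    linear_combination (norm := module) h1 • R ψ

/-- The Taylor coefficients of `1 + ⟨(A - z)⁻¹ ψ, φ⟩` at a point `μ` at which `A - μ` has the
bounded inverse `R`. -/
noncomputable def taylorCoeff (R : H →L[ℂ] H) (φ ψ : H) : ℕ → ℂ
  | 0 => 1 + inner ℂ φ (R ψ)
  | j + 1 => inner ℂ φ ((R ^ (j + 2)) ψ)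

theorem linearIndependent_pow_apply (hinj : Function.Injective R) {φ ψ : H} (q : ℕ)
    (hg : ∀ j < q, taylorCoeff R φ ψ j = 0) :
    LinearIndependent ℂ fun j : Fin q => (R ^ (j.val + 1)) ψ := by
  induction q with
  | zero => exact linearIndependent_empty_type
  | succ q ih =>
    rw [linearIndependent_finSucc]
    constructor
    · have h1 := (ih fun j hj => hg j (by omega)).map' (R : H →ₗ[ℂ] H)
        (LinearMap.ker_eq_bot.2 hinj)
      have h2 : (Fin.tail fun j : Fin (q + 1) => (R ^ (j.val + 1)) ψ) =
          (R : H →ₗ[ℂ] H) ∘ fun j : Fin q => (R ^ (j.val + 1)) ψ := by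
        funext j
        simp [Fin.tail, pow_succ' R (j.val + 1)]
      rw [h2]
      exact h1
    · -- the functional `⟨·, φ⟩` vanishes on the other vectors, and is `-1` on `R ψ`
      intro hmem
      have h1 : Submodule.span ℂ (Set.range (Fin.tail fun j : Fin (q + 1) => (R ^ (j.val + 1)) ψ)) ≤
          LinearMap.ker (innerₛₗ ℂ φ) := by
        rw [Submodule.span_le]
        rintro _ ⟨j, rfl⟩
        have := hg (j.val + 1) (by omega)
        simpa [Fin.tail, taylorCoeff] using this
      have h2 : inner ℂ φ (R ψ) = 0 := by simpa using h1 hmem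
      have h3 := hg 0 (by omega)
      rw [taylorCoeff, h2, add_zero] at h3
      exact one_ne_zero h3

/-- If `p` is the order of the zero of `1 + ⟨(A - z)⁻¹ ψ, φ⟩` at `μ`, then the vectors
`R ψ, …, R ^ p ψ` form a Jordan chain which spans the root subspace of `A + ⟨·, φ⟩ ψ`. -/
theorem rootSubspace_perturb_eq_span
    (hR : ∀ y : H, ∃ h : R y ∈ A.domain, shift A μ ⟨R y, h⟩ = y)
    (hR' : ∀ x : A.domain, R (shift A μ x) = x) {φ ψ : H} {p : ℕ}
    (hg : ∀ j < p, taylorCoeff R φ ψ j = 0) (hp : taylorCoeff R φ ψ p ≠ 0) :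
    rootSubspace (perturb A φ ψ) μ =
      Submodule.span ℂ (Set.range fun j : Fin p => (R ^ (j.val + 1)) ψ) := by
  set W := Submodule.span ℂ (Set.range fun j : Fin p => (R ^ (j.val + 1)) ψ) with hW
  have hmemW : ∀ j < p, (R ^ (j + 1)) ψ ∈ W := fun j hj => Submodule.subset_span ⟨⟨j, hj⟩, rfl⟩
  refine le_antisymm (iSup_le fun k => ?_) ?_
  · induction k with
    | zero => exact bot_le
    | succ k ih =>
      intro y hy
      obtain ⟨hyd, hw⟩ := (mem_kerPow_succ _ μ k y).1 hy
      have hyA : y ∈ A.domain := mem_perturb_domain.1 hyd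
      replace hw := ih hw
      set w := shift (perturb A φ ψ) μ ⟨y, hyd⟩ with hwdef
      have hy1 : y = R w - inner ℂ φ y • R ψ := by
        rw [hwdef, shift_perturb_apply _ hyA, map_add, map_smul, hR' ⟨y, hyA⟩, add_sub_cancel_right]
      have hy2 : inner ℂ φ y * taylorCoeff R φ ψ 0 = inner ℂ φ (R w) := by
        have := congrArg (inner ℂ φ) hy1
        rw [inner_sub_right, inner_smul_right] at this
        rw [taylorCoeff]
        linear_combination this
      rcases Nat.eq_zero_or_pos p with rfl | hp0
      · have hw0 : w = 0 := by simpa [hW] using hw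
        rw [hw0, map_zero, inner_zero_right, mul_eq_zero, or_iff_left hp] at hy2
        rw [hy1, hy2, hw0]
        simp
      · -- On the span, `R` raises the index, and only the last vector of the chain leaves it.
        have key : ∃ x : ℂ, R w - x • (R ^ (p + 1)) ψ ∈ W ∧
            inner ℂ φ (R w) = x * taylorCoeff R φ ψ p := by
          clear_value w
          clear hwdef hy1 hy2
          induction hw using Submodule.span_induction with
          | mem w hw =>
            obtain ⟨j, rfl⟩ := hw
            have hRj : R ((R ^ (j.val + 1)) ψ) = (R ^ (j.val + 1 + 1)) ψ := by
              rw [pow_succ' R (j.val + 1)]; rfl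
            dsimp only
            rw [hRj]
            rcases Nat.lt_or_ge (j.val + 1) p with h | h
            · refine ⟨0, by simpa using hmemW _ h, ?_⟩
              rw [zero_mul]
              exact hg _ h
            · have hj : j.val + 1 = p := by omega
              refine ⟨1, by simp [hj], ?_⟩
              rw [one_mul]
              have h1 : taylorCoeff R φ ψ (j.val + 1) = inner ℂ φ ((R ^ (j.val + 1 + 1)) ψ) := rfl
              rw [← h1]
              exact congrArg _ hj
          | zero => exact ⟨0, by simp, by simp⟩
          | add a b _ _ ha hb =>
            obtain ⟨x, hx, hx'⟩ := ha
            obtain ⟨x', hb, hb'⟩ := hb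
            refine ⟨x + x', ?_, ?_⟩
            · convert W.add_mem hx hb using 1
              rw [map_add, add_smul]
              abel
            · rw [map_add, inner_add_right, hx', hb', add_mul]
          | smul c a _ ha =>
            obtain ⟨x, hx, hx'⟩ := ha
            refine ⟨c * x, ?_, ?_⟩
            · convert W.smul_mem c hx using 1
              rw [map_smul, mul_smul, smul_sub]
            · rw [map_smul, inner_smul_right, hx', mul_assoc]
        obtain ⟨x, hx, hx'⟩ := key
        rw [hg 0 hp0, mul_zero, hx', eq_comm, mul_eq_zero, or_iff_left hp] at hy2
        rw [hy2, zero_smul, sub_zero] at hx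
        rw [hy1]
        exact W.sub_mem hx (W.smul_mem _ (by simpa using hmemW 0 hp0))
  · rw [hW, Submodule.span_le]
    rintro _ ⟨⟨j, hj⟩, rfl⟩
    refine (mem_rootSubspace _ _ _).2 ⟨j + 1, ?_⟩
    dsimp only
    induction j with
    | zero =>
      obtain ⟨h1, h2⟩ := hR ψ
      rw [zero_add, pow_one]
      refine (mem_kerPow_succ _ _ _ _).2 ⟨mem_perturb_domain.2 h1, ?_⟩
      rw [shift_perturb_apply _ h1]
      have h3 := hg 0 hj
      rw [taylorCoeff] at h3
      rw [h2]
      have h4 : ψ + inner ℂ φ (R ψ) • ψ = (1 + inner ℂ φ (R ψ)) • ψ := by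
        rw [add_smul, one_smul]
      rw [h4, h3, zero_smul]
      exact Submodule.zero_mem _
    | succ j ih =>
      have hRj : (R ^ (j + 1 + 1)) ψ = R ((R ^ (j + 1)) ψ) := by
        rw [pow_succ' R (j + 1)]; rfl
      obtain ⟨h1, h2⟩ := hR ((R ^ (j + 1)) ψ)
      have h3 : inner ℂ φ ((R ^ (j + 1 + 1)) ψ) = 0 := hg (j + 1) hj
      rw [hRj] at h3 ⊢
      refine (mem_kerPow_succ _ _ _ _).2 ⟨mem_perturb_domain.2 h1, ?_⟩
      rw [shift_perturb_apply _ h1, h3, zero_smul, add_zero, h2]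
      exact ih (by omega)

/-- Suppose that `A - μ` has a bounded inverse and that `1 + ⟨(A - z)⁻¹ ψ, φ⟩` has a zero of
order `p` at `μ`; the vector `(A - z)⁻¹ ψ` is given here as `y z`. Then `p` is the algebraic
multiplicity of `μ` for `A + ⟨·, φ⟩ ψ`. -/
theorem finrank_rootSubspace_perturb (hμ : μ ∈ resolventSet A) {φ ψ : H} {y : ℂ → H}
    (hy : ∀ᶠ z in 𝓝[≠] μ, ∃ hz : y z ∈ A.domain, shift A z ⟨y z, hz⟩ = ψ)
    {h : ℂ → ℂ} {l : ℂ} {p : ℕ} (hl : l ≠ 0) (hlim : Tendsto h (𝓝[≠] μ) (𝓝 l))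
    (heq : ∀ᶠ z in 𝓝[≠] μ, 1 + inner ℂ φ (y z) = (z - μ) ^ p * h z) :
    Module.Finite ℂ (rootSubspace (perturb A φ ψ) μ) ∧
      Module.finrank ℂ (rootSubspace (perturb A φ ψ) μ) = p ∧
      (p = 0 → μ ∈ resolventSet (perturb A φ ψ)) := by
  obtain ⟨R, hR, hR'⟩ := hμ
  have hu : Tendsto (fun z : ℂ => z - μ) (𝓝[≠] μ) (𝓝 0) := by
    have : Tendsto (fun z : ℂ => z - μ) (𝓝 μ) (𝓝 (μ - μ)) := tendsto_id.sub_const _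
    rw [sub_self] at this
    exact this.mono_left nhdsWithin_le_nhds
  have hrec : ∀ᶠ z in 𝓝[≠] μ, y z = R ψ + (z - μ) • R (y z) := by
    filter_upwards [hy] with z ⟨hz, hz'⟩
    have h1 : shift A μ ⟨y z, hz⟩ = ψ + (z - μ) • y z := by
      rw [← hz', shift_apply, shift_apply, sub_smul]
      simp
    rw [← map_smul, ← map_add, ← h1]
    exact (hR' ⟨y z, hz⟩).symm
  have hbound : ∀ᶠ z in 𝓝[≠] μ, ‖y z‖ ≤ 2 * ‖R ψ‖ := by
    have h1 : Tendsto (fun z : ℂ => ‖z - μ‖ * ‖R‖) (𝓝[≠] μ) (𝓝 (‖(0 : ℂ)‖ * ‖R‖)) :=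
      hu.norm.mul_const _
    rw [norm_zero, zero_mul] at h1
    filter_upwards [hrec, h1.eventually (gt_mem_nhds one_half_pos)] with z hz hz1
    have h2 : ‖y z‖ ≤ ‖R ψ‖ + ‖z - μ‖ * ‖R‖ * ‖y z‖ := by
      calc ‖y z‖ = ‖R ψ + (z - μ) • R (y z)‖ := by rw [← hz]
        _ ≤ ‖R ψ‖ + ‖(z - μ) • R (y z)‖ := norm_add_le _ _
        _ ≤ _ := by
          rw [norm_smul, mul_assoc]
          gcongr
          exact R.le_opNorm _
    have h3 : ‖z - μ‖ * ‖R‖ * ‖y z‖ ≤ 1 / 2 * ‖y z‖ := by gcongr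
    linarith
  have hexp : ∀ᶠ z in 𝓝[≠] μ, ∀ q : ℕ, 1 + inner ℂ φ (y z) =
      ∑ j ∈ Finset.range (q + 1), (z - μ) ^ j * taylorCoeff R φ ψ j +
        (z - μ) ^ (q + 1) * inner ℂ φ ((R ^ (q + 1)) (y z)) := by
    filter_upwards [hrec] with z hz q
    induction q with
    | zero =>
      nth_rewrite 1 [hz]
      rw [inner_add_right, inner_smul_right]
      simp [taylorCoeff, add_assoc]
    | succ q ih =>
      rw [ih, Finset.sum_range_succ _ (q + 1), add_assoc]
      congr 1
      nth_rewrite 1 [hz]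
      rw [map_add, map_smul, inner_add_right, inner_smul_right, taylorCoeff,
        pow_succ R (q + 1)]
      simp only [mul_apply_eq_comp]
      ring
  have hr : Tendsto (fun z => (z - μ) * inner ℂ φ ((R ^ (p + 1)) (y z))) (𝓝[≠] μ) (𝓝 0) := by
    have h1 : Tendsto (fun z : ℂ => ‖z - μ‖ * (‖φ‖ * (‖R ^ (p + 1)‖ * (2 * ‖R ψ‖)))) (𝓝[≠] μ)
        (𝓝 (‖(0 : ℂ)‖ * (‖φ‖ * (‖R ^ (p + 1)‖ * (2 * ‖R ψ‖))))) := hu.norm.mul_const _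
    rw [norm_zero, zero_mul] at h1
    refine squeeze_zero_norm' ?_ h1
    filter_upwards [hbound] with z hz
    rw [norm_mul]
    gcongr
    refine (norm_inner_le_norm _ _).trans ?_
    gcongr
    exact (ContinuousLinearMap.le_opNorm _ _).trans (by gcongr)
  obtain ⟨hg, hgp⟩ := eq_zero_and_eq_of_expansion p hr hlim (by
    filter_upwards [hexp, heq] with z h1 h2
    rw [← h1 p, h2])
  have hgp' : taylorCoeff R φ ψ p ≠ 0 := hgp.symm ▸ hl
  rw [rootSubspace_perturb_eq_span hR hR' hg hgp']
  refine ⟨Module.Finite.span_of_finite ℂ (Set.finite_range _), ?_, ?_⟩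
  · rw [finrank_span_eq_card (linearIndependent_pow_apply (resolvent_injective hR) p hg),
      Fintype.card_fin]
  · rintro rfl
    exact mem_resolventSet_perturb hR hR' hgp'

end Multiplicity

end RankOne

/-! ### Diagonal operators -/

namespace RankOne

section Diagonal

variable {H : Type*} [NormedAddCommGroup H] [InnerProductSpace ℂ H] {ι : Type*}

/-- The operator `A` is the maximal diagonal operator with eigenvalues `lam n` in the Hilbert
basis `b`. -/
structure IsDiagonal (A : H →ₗ.[ℂ] H) (b : HilbertBasis ι ℂ H) (lam : ι → ℂ) : Prop where
  inner_apply : ∀ (x : A.domain) (n : ι), inner ℂ (b n) (A x) = lam n * inner ℂ (b n) (x : H)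
  mem_domain : ∀ y w : H, (∀ n, inner ℂ (b n) w = lam n * inner ℂ (b n) y) → y ∈ A.domain

theorem ext_coeff (b : HilbertBasis ι ℂ H) {x y : H}
    (h : ∀ n, inner ℂ (b n) x = inner ℂ (b n) y) : x = y := by
  refine b.repr.injective (lp.ext (funext fun n => ?_))
  rw [b.repr_apply_apply, b.repr_apply_apply, h]

theorem exists_diagonal_clm (b : HilbertBasis ι ℂ H) {m : ι → ℂ} {C : ℝ} (hm : ∀ n, ‖m n‖ ≤ C) :
    ∃ R : H →L[ℂ] H, ∀ x n, inner ℂ (b n) (R x) = m n * inner ℂ (b n) x := by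
  have h2 : 0 < (2 : ENNReal).toReal := by norm_num
  have hle : ∀ (x : H) (n : ι), ‖m n * b.repr x n‖ ^ (2 : ENNReal).toReal ≤
      |C| ^ (2 : ENNReal).toReal * ‖b.repr x n‖ ^ (2 : ENNReal).toReal := by
    intro x n
    rw [norm_mul, ← Real.mul_rpow (abs_nonneg _) (norm_nonneg _)]
    refine Real.rpow_le_rpow (by positivity) ?_ h2.le
    exact mul_le_mul_of_nonneg_right ((hm n).trans (le_abs_self C)) (norm_nonneg _)
  have hsum : ∀ x : H, HasSum (fun n => |C| ^ (2 : ENNReal).toReal *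
      ‖b.repr x n‖ ^ (2 : ENNReal).toReal)
      (|C| ^ (2 : ENNReal).toReal * ‖b.repr x‖ ^ (2 : ENNReal).toReal) :=
    fun x => (lp.hasSum_norm h2 (b.repr x)).mul_left _
  have hmem : ∀ x : H, Memℓp (fun n => m n * b.repr x n) 2 := fun x =>
    memℓp_gen (Summable.of_nonneg_of_le (fun _ => by positivity) (hle x) (hsum x).summable)
  let T : H →ₗ[ℂ] H :=
    { toFun := fun x => b.repr.symm ⟨fun n => m n * b.repr x n, hmem x⟩
      map_add' := fun x y => by
        rw [← map_add]
        congr 1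
        refine lp.ext (funext fun n => ?_)
        simp only [map_add, lp.coeFn_add, Pi.add_apply, mul_add]
      map_smul' := fun c x => by
        rw [RingHom.id_apply, ← map_smul]
        congr 1
        refine lp.ext (funext fun n => ?_)
        simp [mul_left_comm] }
  have hT : ∀ x n, b.repr (T x) n = m n * b.repr x n := by
    intro x n
    simp only [T, LinearMap.coe_mk, AddHom.coe_mk, LinearIsometryEquiv.apply_symm_apply]
  refine ⟨T.mkContinuous |C| fun x => ?_, fun x n => ?_⟩
  · have h3 := hasSum_le (fun n => (hT x n) ▸ hle x n) (lp.hasSum_norm h2 (b.repr (T x))) (hsum x)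
    rw [← Real.mul_rpow (abs_nonneg _) (norm_nonneg _)] at h3
    have h4 := (Real.rpow_le_rpow_iff (norm_nonneg _) (by positivity) h2).1 h3
    simpa using h4
  · have := hT x n
    rwa [b.repr_apply_apply, b.repr_apply_apply] at this

namespace IsDiagonal

variable {A : H →ₗ.[ℂ] H} {b : HilbertBasis ι ℂ H} {lam : ι → ℂ}

theorem mem_resolventSet (hA : IsDiagonal A b lam) {z : ℂ} {δ : ℝ} (hδ : 0 < δ)
    (h : ∀ n, δ ≤ ‖lam n - z‖) : z ∈ resolventSet A := by
  have hne : ∀ n, lam n - z ≠ 0 := fun n => norm_pos_iff.1 (hδ.trans_le (h n))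
  obtain ⟨R, hR⟩ := exists_diagonal_clm b (m := fun n => (lam n - z)⁻¹) (C := δ⁻¹) fun n => by
    rw [norm_inv]
    exact inv_anti₀ hδ (h n)
  refine ⟨R, fun y => ?_, fun x => ?_⟩
  · have hmem : R y ∈ A.domain := by
      refine hA.mem_domain (R y) (y + z • R y) fun n => ?_
      rw [inner_add_right, inner_smul_right, hR]
      have := hne n
      field_simp
      ring
    refine ⟨hmem, ext_coeff b fun n => ?_⟩
    rw [shift_apply, inner_sub_right, inner_smul_right, hA.inner_apply, hR]
    have := hne n
    field_simp
  · refine ext_coeff b fun n => ?_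
    rw [hR, shift_apply, inner_sub_right, inner_smul_right, hA.inner_apply]
    have := hne n
    field_simp

/-- The coefficients of `(A - z)⁻¹ ψ`. -/
theorem inner_eq_div (hA : IsDiagonal A b lam) {z : ℂ} (hz : ∀ n, z ≠ lam n) {y ψ : H}
    (hy : y ∈ A.domain) (h : shift A z ⟨y, hy⟩ = ψ) (n : ι) :
    inner ℂ (b n) y = inner ℂ (b n) ψ / (lam n - z) := by
  have hne : lam n - z ≠ 0 := sub_ne_zero.2 (hz n).symm
  rw [← h, shift_apply, inner_sub_right, inner_smul_right, hA.inner_apply]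
  field_simp

theorem basis_mem_domain (hA : IsDiagonal A b lam) (k : ι) : b k ∈ A.domain := by
  classical
  refine hA.mem_domain (b k) (lam k • b k) fun n => ?_
  rw [inner_smul_right, orthonormal_iff_ite.1 b.orthonormal n k]
  split_ifs with h
  · rw [h]
  · simp

theorem apply_basis (hA : IsDiagonal A b lam) (k : ι) (h : b k ∈ A.domain) :
    A ⟨b k, h⟩ = lam k • b k := by
  classical
  refine ext_coeff b fun n => ?_
  rw [hA.inner_apply, inner_smul_right, orthonormal_iff_ite.1 b.orthonormal n k]
  split_ifs with h
  · rw [h]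
  · simp

open Classical in
/-- Adding the orthogonal projection onto a basis vector moves one eigenvalue. -/
theorem perturb_basis (hA : IsDiagonal A b lam) (k : ι) :
    IsDiagonal (perturb A (b k) (b k)) b (Function.update lam k (lam k + 1)) where
  inner_apply x n := by
    have h1 := hA.inner_apply ⟨x, mem_perturb_domain.1 x.2⟩ n
    have h2 : (perturb A (b k) (b k)) x =
        A ⟨x, mem_perturb_domain.1 x.2⟩ + inner ℂ (b k) (x : H) • b k := rfl
    rw [h2, inner_add_right, inner_smul_right, orthonormal_iff_ite.1 b.orthonormal n k, h1]
    rcases eq_or_ne n k with rfl | hn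
    · rw [Function.update_self, if_pos rfl]
      ring
    · rw [Function.update_of_ne hn, if_neg hn]
      ring
  mem_domain y w h := by
    refine mem_perturb_domain.2 (hA.mem_domain y (w - inner ℂ (b k) y • b k) fun n => ?_)
    rw [inner_sub_right, inner_smul_right, orthonormal_iff_ite.1 b.orthonormal n k, h n]
    rcases eq_or_ne n k with rfl | hn
    · rw [Function.update_self, if_pos rfl]
      ring
    · rw [Function.update_of_ne hn, if_neg hn]
      ring

end IsDiagonal

end Diagonal

/-! ### Completeness of the eigenvectors -/

section Resolvent

variable {H : Type*} [NormedAddCommGroup H] [InnerProductSpace ℂ H]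
  {A : H →ₗ.[ℂ] H} {z : ℝ} {R : H →L[ℂ] H}

/-- A non-zero spectral point `t` of the resolvent `(A - z)⁻¹` comes from the spectral point
`z + 1 / t` of `A`. -/
theorem mem_spectrum_of_mem_spectrum_resolvent
    (hR : ∀ y : H, ∃ h : R y ∈ A.domain, shift A z ⟨R y, h⟩ = y)
    (hR' : ∀ x : A.domain, R (shift A z x) = x) {t : ℂ} (ht0 : t ≠ 0)
    (ht : t ∈ _root_.spectrum ℂ R) : (z : ℂ) + t⁻¹ ∈ spectrum A := by
  rintro ⟨S, hS, hS'⟩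
  refine ht (spectrum.mem_resolventSet_iff.2 ?_)
  have h1 : ∀ y, S y - t⁻¹ • S (R y) = R y := by
    intro y
    obtain ⟨h, h'⟩ := hR y
    have h2 : shift A (z + t⁻¹) ⟨R y, h⟩ = y - t⁻¹ • R y := by
      nth_rewrite 2 [← h']
      rw [shift_apply, shift_apply, add_smul, sub_add_eq_sub_sub]
    rw [← map_smul, ← map_sub, ← h2]
    exact hS' ⟨R y, h⟩
  have h3 : ∀ y, R y + t⁻¹ • R (S y) = S y := by
    intro y
    obtain ⟨h, h'⟩ := hS y
    have h2 : shift A z ⟨S y, h⟩ = y + t⁻¹ • S y := by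
      nth_rewrite 2 [← h']
      rw [shift_apply, shift_apply, add_smul, sub_add_eq_sub_sub, sub_add_cancel]
    rw [← map_smul, ← map_add, ← h2]
    exact hR' ⟨S y, h⟩
  have ht1 : t⁻¹ * t = 1 := inv_mul_cancel₀ ht0
  refine isUnit_iff_exists.2 ⟨t⁻¹ • (1 + t⁻¹ • S), ?_, ?_⟩
  · ext y
    have h4 := h3 y
    simp only [Algebra.algebraMap_eq_smul_one, mul_apply_eq_comp, sub_apply, smul_apply,
      one_apply_eq_self, add_apply, map_smul, map_add]
    linear_combination (norm := module) (-t⁻¹) • h4 + ht1 • (y + t⁻¹ • S y)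
  · ext y
    have h4 := h1 y
    simp only [Algebra.algebraMap_eq_smul_one, mul_apply_eq_comp, sub_apply, smul_apply,
      one_apply_eq_self, add_apply, map_smul, map_sub]
    linear_combination (norm := module) t⁻¹ • h4 + ht1 • (y + t⁻¹ • S y)

end Resolvent

section Completeness

variable {H : Type*} [NormedAddCommGroup H] [InnerProductSpace ℂ H] [CompleteSpace H]

theorem inner_apply_symm {A : H →ₗ.[ℂ] H} (hA : IsSelfAdjoint A) (x y : A.domain) :
    inner ℂ (A x) (y : H) = inner ℂ (x : H) (A y) := by
  have h := LinearPMap.adjoint_isFormalAdjoint hA.dense_domain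
  rw [LinearPMap.isSelfAdjoint_def.1 hA] at h
  exact h x y

variable {A : H →ₗ.[ℂ] H} {z : ℝ} {R : H →L[ℂ] H}

theorem isSelfAdjoint_resolvent (hA : IsSelfAdjoint A)
    (hR : ∀ y : H, ∃ h : R y ∈ A.domain, shift A z ⟨R y, h⟩ = y) : IsSelfAdjoint R := by
  rw [ContinuousLinearMap.isSelfAdjoint_iff_isSymmetric]
  intro x y
  obtain ⟨hx, hx'⟩ := hR x
  obtain ⟨hy, hy'⟩ := hR y
  have h1 := inner_apply_symm hA ⟨R x, hx⟩ ⟨R y, hy⟩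
  rw [shift_apply] at hx' hy'
  change inner ℂ (R x) y = inner ℂ x (R y)
  nth_rewrite 1 [← hy']
  nth_rewrite 2 [← hx']
  rw [inner_sub_right, inner_sub_left, h1, inner_smul_left, inner_smul_right, Complex.conj_ofReal]

variable {ι : Type*} {lam : ι → ℝ} {v : ι → H}

theorem exists_eq_smul_of_mem_eigenspace (hA : HasSimpleSeparatedSpectrum A lam)
    (hv : ∀ n, v n ∈ eigenspace A (lam n)) (hv1 : ∀ n, ‖v n‖ = 1) {n : ι} {w : H}
    (hw : w ∈ eigenspace A (lam n)) : ∃ c : ℂ, w = c • v n := by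
  have hne : (⟨v n, hv n⟩ : eigenspace A (lam n)) ≠ 0 := by
    intro h
    have h0 : v n = 0 := congrArg Subtype.val h
    have := hv1 n
    rw [h0, norm_zero] at this
    exact zero_ne_one this
  obtain ⟨c, hc⟩ := (finrank_eq_one_iff_of_nonzero' _ hne).1 (hA.simple n) ⟨w, hw⟩
  exact ⟨c, (congrArg Subtype.val hc).symm⟩

theorem inner_eigenvector_apply (hA : IsSelfAdjoint A) (hv : ∀ n, v n ∈ eigenspace A (lam n))
    (x : A.domain) (n : ι) : inner ℂ (v n) (A x) = lam n * inner ℂ (v n) (x : H) := by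
  obtain ⟨h, h'⟩ := (mem_eigenspace A _ _).1 (hv n)
  rw [← inner_apply_symm hA ⟨v n, h⟩ x, h', inner_smul_left, Complex.conj_ofReal]

theorem orthonormal_eigenvectors (hA : HasSimpleSeparatedSpectrum A lam)
    (hv : ∀ n, v n ∈ eigenspace A (lam n)) (hv1 : ∀ n, ‖v n‖ = 1) : Orthonormal ℂ v := by
  refine ⟨hv1, fun m n hmn => ?_⟩
  obtain ⟨d, hd, hs⟩ := hA.separated
  obtain ⟨h, h'⟩ := (mem_eigenspace A _ _).1 (hv n)
  have h1 := inner_eigenvector_apply hA.selfAdjoint hv ⟨v n, h⟩ m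
  rw [h', inner_smul_right] at h1
  have h2 : (lam n : ℂ) - lam m ≠ 0 := by
    rw [sub_ne_zero]
    exact fun he => hmn (injective_of_separated hd hs (Complex.ofReal_injective he)).symm
  have h3 : ((lam n : ℂ) - lam m) * inner ℂ (v m) (v n) = 0 := by
    rw [sub_mul, h1, sub_self]
  exact (mul_eq_zero.1 h3).resolve_left h2

theorem exists_real_ne {d : ℝ} (hd : 0 < d) (hs : ∀ m n, m ≠ n → d ≤ |lam m - lam n|) :
    ∃ z : ℝ, ∀ n, z ≠ lam n := by
  rcases isEmpty_or_nonempty ι with h | ⟨⟨k⟩⟩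
  · exact ⟨0, fun n => h.elim n⟩
  · refine ⟨lam k + d / 2, fun n hn => ?_⟩
    rcases eq_or_ne n k with rfl | hnk
    · linarith
    · have := hs n k hnk
      rw [← hn, add_sub_cancel_left, abs_of_pos (half_pos hd)] at this
      linarith

theorem HasSimpleSeparatedSpectrum.exists_real_mem_resolventSet
    (hA : HasSimpleSeparatedSpectrum A lam) :
    ∃ z : ℝ, (∀ n, z ≠ lam n) ∧ (z : ℂ) ∈ resolventSet A := by
  obtain ⟨d, hd, hs⟩ := hA.separated
  obtain ⟨z, hz⟩ := exists_real_ne hd hs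
  refine ⟨z, hz, ?_⟩
  by_contra h
  have h1 : (z : ℂ) ∈ spectrum A := h
  rw [hA.spectrum_eq] at h1
  obtain ⟨n, hn⟩ := h1
  exact hz n (Complex.ofReal_injective hn.symm)

/-- The eigenvectors are complete: the resolvent at a real point is a self-adjoint bounded operator
whose non-zero spectral points are isolated, and spectral projections to them, by the continuous
functional calculus, project to eigenspaces of `A`. -/
theorem eq_zero_of_inner_eigenvectors_eq_zero (hA : HasSimpleSeparatedSpectrum A lam)
    (hv : ∀ n, v n ∈ eigenspace A (lam n)) (hv1 : ∀ n, ‖v n‖ = 1) {x : H}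
    (hx : ∀ n, inner ℂ (v n) x = 0) : x = 0 := by
  obtain ⟨d, hd, hs⟩ := hA.separated
  obtain ⟨z, hz, hzres⟩ := hA.exists_real_mem_resolventSet
  obtain ⟨R, hR, hR'⟩ := hzres
  have hsa : IsSelfAdjoint R := isSelfAdjoint_resolvent hA.selfAdjoint hR
  set σ := _root_.spectrum ℝ R with hσdef
  have hσ : ∀ t ∈ σ, t ≠ 0 → ∃ n, lam n = z + t⁻¹ := by
    intro t ht ht0
    have h1 := mem_spectrum_of_mem_spectrum_resolvent hR hR' (t := (t : ℂ)) (by exact_mod_cast ht0)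
      ((spectrum.algebraMap_mem_iff ℂ).2 ht)
    rw [hA.spectrum_eq] at h1
    obtain ⟨n, hn⟩ := h1
    refine ⟨n, ?_⟩
    have hn' : (lam n : ℂ) = z + (t : ℂ)⁻¹ := hn
    exact_mod_cast hn'
  have hfin : ∀ ε > 0, (σ ∩ {t | ε ≤ |t|}).Finite := by
    intro ε hε
    refine ((finite_abs_le_of_separated hd hs (|z| + ε⁻¹)).image
      (fun n => (lam n - z)⁻¹)).subset ?_
    rintro t ⟨ht, hεt : ε ≤ |t|⟩
    have ht0 : t ≠ 0 := abs_pos.1 (hε.trans_le hεt)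
    obtain ⟨n, hn⟩ := hσ t ht ht0
    refine ⟨n, ?_, ?_⟩
    · change |lam n| ≤ |z| + ε⁻¹
      rw [hn]
      refine (abs_add_le _ _).trans ?_
      rw [abs_inv]
      gcongr
    · dsimp only
      rw [hn, add_sub_cancel_left, inv_inv]
  -- The points of `σ` other than `0` are isolated, so only the behaviour near `0` matters.
  have hcont : ∀ (f : ℝ → ℝ) (ε : ℝ), 0 < ε → (∀ t, |t| < ε → f t = 0) → ContinuousOn f σ := by
    intro f ε hε hf t _
    rcases lt_or_ge |t| ε with h | h
    · have h1 : ∀ᶠ s in 𝓝[σ] t, f t = f s := by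
        refine eventually_nhdsWithin_of_eventually_nhds ?_
        filter_upwards [(isOpen_lt continuous_abs continuous_const).mem_nhds h] with s hs'
        rw [hf t h, hf s hs']
      exact tendsto_const_nhds.congr' h1
    · have h1 : ∀ᶠ s in 𝓝[σ] t, f t = f s := by
        have hclosed : IsClosed ((σ ∩ {s | ε / 2 ≤ |s|}) \ {t}) :=
          ((hfin (ε / 2) (half_pos hε)).subset Set.sdiff_subset).isClosed
        have h2 : ((σ ∩ {s | ε / 2 ≤ |s|}) \ {t})ᶜ ∈ 𝓝 t :=
          hclosed.isOpen_compl.mem_nhds fun h => h.2 rfl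
        have h3 : {s | ε / 2 < |s|} ∈ 𝓝 t :=
          (isOpen_lt continuous_const continuous_abs).mem_nhds
            (show ε / 2 < |t| by linarith)
        filter_upwards [self_mem_nhdsWithin, mem_nhdsWithin_of_mem_nhds h2,
          mem_nhdsWithin_of_mem_nhds h3] with s hs1 hs2 hs3
        have : s = t := by
          by_contra hst
          exact hs2 ⟨⟨hs1, le_of_lt hs3⟩, hst⟩
        rw [this]
      exact tendsto_const_nhds.congr' h1
  -- In particular, the indicator function of a non-zero point is continuous on `σ`.
  have hcont1 : ∀ t : ℝ, t ≠ 0 → ContinuousOn (fun s : ℝ => if s = t then (1 : ℝ) else 0) σ := by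
    intro t ht
    refine hcont _ |t| (abs_pos.2 ht) fun s hs' => if_neg ?_
    rintro rfl
    exact lt_irrefl _ hs'
  -- The range of a spectral projection is spanned by one `v n`, and `x` is orthogonal to `v n`.
  have hproj : ∀ t ∈ σ, t ≠ 0 → cfc (fun s : ℝ => if s = t then (1 : ℝ) else 0) R x = 0 := by
    intro t ht ht0
    obtain ⟨n, hn⟩ := hσ t ht ht0
    set P := cfc (fun s : ℝ => if s = t then (1 : ℝ) else 0) R with hP
    have hRP : R * P = t • P := by
      have h1 : R * P = cfc (fun s : ℝ => s * if s = t then (1 : ℝ) else 0) R := by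
        rw [cfc_mul (fun s : ℝ => s) _ R continuousOn_id (hcont1 t ht0), cfc_id' ℝ R]
      rw [h1, hP, ← cfc_const_mul t _ R (hcont1 t ht0)]
      refine cfc_congr fun s _ => ?_
      split_ifs with h
      · rw [h]
      · simp
    have hPu : ∀ u, ∃ c : ℂ, P u = c • v n := by
      intro u
      refine exists_eq_smul_of_mem_eigenspace hA hv hv1 ((mem_eigenspace _ _ _).2 ?_)
      have h1 : R (P u) = (t : ℂ) • P u := by
        have := congrArg (fun T : H →L[ℂ] H => T u) hRP
        simpa using this
      obtain ⟨h2, h3⟩ := hR ((t : ℂ)⁻¹ • P u)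
      have h4 : R ((t : ℂ)⁻¹ • P u) = P u := by
        rw [map_smul, h1, smul_smul, inv_mul_cancel₀ (by exact_mod_cast ht0), one_smul]
      simp only [h4] at h2 h3
      refine ⟨h2, ?_⟩
      rw [shift_apply, sub_eq_iff_eq_add] at h3
      rw [h3, hn, ← add_smul]
      push_cast
      rw [add_comm]
    have hPsa : IsSelfAdjoint P := cfc_predicate _ R
    obtain ⟨c, hc⟩ := hPu x
    obtain ⟨c', hc'⟩ := hPu (v n)
    have h1 : inner ℂ (v n) (P x) = 0 := by
      have h2 := (ContinuousLinearMap.isSelfAdjoint_iff_isSymmetric.1 hPsa) (v n) x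
      change inner ℂ (P (v n)) x = inner ℂ (v n) (P x) at h2
      rw [← h2, hc', inner_smul_left, hx n, mul_zero]
    rw [hc, inner_smul_right, inner_self_eq_norm_sq_to_K, hv1 n] at h1
    have h2 : c = 0 := by simpa using h1
    rw [hc, h2, zero_smul]
  have hRx : ∀ ε > 0, ‖R x‖ ≤ ε * ‖x‖ := by
    intro ε hε
    set F := (hfin ε hε).toFinset with hF
    have hF0 : ∀ t ∈ F, t ∈ σ ∧ t ≠ 0 := by
      intro t ht
      obtain ⟨h1, h2 : ε ≤ |t|⟩ := (hfin ε hε).mem_toFinset.1 ht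
      exact ⟨h1, abs_pos.1 (hε.trans_le h2)⟩
    have hcF : ∀ t ∈ F, ContinuousOn (fun s : ℝ => t * if s = t then (1 : ℝ) else 0) σ :=
      fun t ht => continuousOn_const.mul (hcont1 t (hF0 t ht).2)
    have hcS : ContinuousOn (∑ t ∈ F, fun s : ℝ => t * if s = t then (1 : ℝ) else 0) σ := by
      have := continuousOn_finsetSum F hcF
      refine this.congr fun s _ => ?_
      rw [Finset.sum_apply]
    have hQx : cfc (∑ t ∈ F, fun s : ℝ => t * if s = t then (1 : ℝ) else 0) R x = 0 := by
      rw [cfc_sum _ R F hcF, sum_apply]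
      refine Finset.sum_eq_zero fun t ht => ?_
      rw [cfc_const_mul t _ R (hcont1 t (hF0 t ht).2), smul_apply,
        hproj t (hF0 t ht).1 (hF0 t ht).2, smul_zero]
    have h1 : ‖cfc (fun s : ℝ => s - (∑ t ∈ F, fun s : ℝ => t * if s = t then (1 : ℝ) else 0) s)
        R‖ ≤ ε := by
      refine norm_cfc_le hε.le fun s hs' => ?_
      rw [Finset.sum_apply]
      simp only [mul_ite, mul_one, mul_zero]
      rw [Finset.sum_ite_eq]
      split_ifs with h
      · simpa using hε.le
      · rw [sub_zero, Real.norm_eq_abs]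
        by_contra hlt
        exact h ((hfin ε hε).mem_toFinset.2 ⟨hs', (not_le.1 hlt).le⟩)
    rw [cfc_sub (fun s : ℝ => s) _ R continuousOn_id hcS, cfc_id' ℝ R] at h1
    calc ‖R x‖ = ‖(R - cfc (∑ t ∈ F, fun s : ℝ => t * if s = t then (1 : ℝ) else 0) R) x‖ := by
          rw [sub_apply, hQx, sub_zero]
      _ ≤ _ := ContinuousLinearMap.le_of_opNorm_le _ h1 x
  have hR0 : R x = 0 := by
    rw [← norm_le_zero_iff]
    refine le_of_forall_pos_le_add fun ε hε => ?_
    refine (hRx (ε / (‖x‖ + 1)) (by positivity)).trans ?_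
    rw [zero_add, div_mul_eq_mul_div, div_le_iff₀ (by positivity)]
    nlinarith [norm_nonneg x]
  exact resolvent_injective hR (by rw [hR0, map_zero])

/-- The operator `A` is the maximal diagonal operator in the Hilbert basis of its eigenvectors. -/
theorem exists_hilbertBasis_isDiagonal (hA : HasSimpleSeparatedSpectrum A lam)
    (hv : ∀ n, v n ∈ eigenspace A (lam n)) (hv1 : ∀ n, ‖v n‖ = 1) :
    ∃ b : HilbertBasis ι ℂ H, ⇑b = v ∧ IsDiagonal A b fun n => (lam n : ℂ) := by
  have hcomplete : (Submodule.span ℂ (Set.range v))ᗮ = ⊥ := by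
    refine (Submodule.eq_bot_iff _).2 fun x hx => ?_
    refine eq_zero_of_inner_eigenvectors_eq_zero hA hv hv1 fun n => ?_
    exact (Submodule.mem_orthogonal _ _).1 hx _ (Submodule.subset_span ⟨n, rfl⟩)
  set b := HilbertBasis.mkOfOrthogonalEqBot (orthonormal_eigenvectors hA hv hv1) hcomplete with hb
  have hbv : ⇑b = v := HilbertBasis.coe_mkOfOrthogonalEqBot _ _
  refine ⟨b, hbv, ⟨fun x n => ?_, fun y w h => ?_⟩⟩
  · rw [hbv]
    exact inner_eigenvector_apply hA.selfAdjoint hv x n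
  · obtain ⟨z, hz, hzres⟩ := hA.exists_real_mem_resolventSet
    obtain ⟨R, hR, hR'⟩ := hzres
    -- `y` is recovered as the image of `w - z y` under the resolvent
    obtain ⟨h1, h2⟩ := hR (w - (z : ℂ) • y)
    suffices y = R (w - (z : ℂ) • y) by rw [this]; exact h1
    refine ext_coeff b fun n => ?_
    have h3 := inner_eigenvector_apply hA.selfAdjoint hv ⟨_, h1⟩ n
    rw [← hbv] at h3
    have h4 := congrArg (inner ℂ (b n)) h2
    rw [shift_apply, inner_sub_right, inner_sub_right, inner_smul_right, inner_smul_right, h3,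
      h n, ← sub_mul, ← sub_mul] at h4
    have h5 : (lam n : ℂ) - z ≠ 0 := sub_ne_zero.2 fun h => hz n (Complex.ofReal_injective h).symm
    exact (mul_left_cancel₀ h5 h4).symm

end Completeness

end RankOne

/-! ### The spectrum of the perturbed operator -/

namespace RankOne

section Splitting

variable {H : Type*} [NormedAddCommGroup H] [InnerProductSpace ℂ H]

theorem perturb_perturb_left (A : H →ₗ.[ℂ] H) (φ ψ₁ ψ₂ : H) :
    perturb (perturb A φ ψ₁) φ ψ₂ = perturb A φ (ψ₁ + ψ₂) := by
  refine LinearPMap.ext rfl fun x h1 h2 => ?_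
  change A ⟨x, h1⟩ + inner ℂ φ x • ψ₁ + inner ℂ φ x • ψ₂ = A ⟨x, h1⟩ + inner ℂ φ x • (ψ₁ + ψ₂)
  rw [smul_add, add_assoc]

theorem perturb_perturb_right (A : H →ₗ.[ℂ] H) (φ₁ φ₂ ψ : H) :
    perturb (perturb A φ₁ ψ) φ₂ ψ = perturb A (φ₁ + φ₂) ψ := by
  refine LinearPMap.ext rfl fun x h1 h2 => ?_
  change A ⟨x, h1⟩ + inner ℂ φ₁ x • ψ + inner ℂ φ₂ x • ψ = A ⟨x, h1⟩ + inner ℂ (φ₁ + φ₂) x • ψ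
  rw [inner_add_left, add_smul, add_assoc]

theorem perturb_comm (A : H →ₗ.[ℂ] H) (φ₁ ψ₁ φ₂ ψ₂ : H) :
    perturb (perturb A φ₁ ψ₁) φ₂ ψ₂ = perturb (perturb A φ₂ ψ₂) φ₁ ψ₁ := by
  refine LinearPMap.ext rfl fun x h1 h2 => ?_
  change A ⟨x, h1⟩ + inner ℂ φ₁ x • ψ₁ + inner ℂ φ₂ x • ψ₂ =
    A ⟨x, h1⟩ + inner ℂ φ₂ x • ψ₂ + inner ℂ φ₁ x • ψ₁
  abel

variable {T : H →ₗ.[ℂ] H} {μ : ℂ} {v : H}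

/-- If `v` is a unit eigenvector of `T` and `v⊥` reduces `T`, then moving the eigenvalue `μ` of `v`
away from `μ` lowers the algebraic multiplicity of `μ` by one. -/
theorem finrank_rootSubspace_eq_succ (hv1 : ‖v‖ = 1) (hv : v ∈ eigenspace T μ)
    (hT : ∀ x : T.domain, inner ℂ v (T x) = μ * inner ℂ v (x : H))
    (hfin : Module.Finite ℂ (rootSubspace (perturb T v v) μ)) :
    Module.Finite ℂ (rootSubspace T μ) ∧ Module.finrank ℂ (rootSubspace T μ) =
      Module.finrank ℂ (rootSubspace (perturb T v v) μ) + 1 := by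
  have hvv : inner ℂ v v = (1 : ℂ) := by
    rw [inner_self_eq_norm_sq_to_K, hv1]
    simp
  obtain ⟨hvd, hvT⟩ := (mem_eigenspace T μ v).1 hv
  have hshift : ∀ x (hx : x ∈ T.domain), inner ℂ v (shift T μ ⟨x, hx⟩) = 0 := by
    intro x hx
    rw [shift_apply, inner_sub_right, inner_smul_right, hT, sub_self]
  have h1 : ∀ k y, y ∈ kerPow (perturb T v v) μ k → inner ℂ v y = 0 ∧ y ∈ kerPow T μ k := by
    intro k
    induction k with
    | zero =>
      intro y hy
      have hy0 : y = 0 := hy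
      rw [hy0]
      exact ⟨inner_zero_right _, Submodule.zero_mem _⟩
    | succ k ih =>
      intro y hy
      obtain ⟨hyd, hy⟩ := (mem_kerPow_succ _ _ _ _).1 hy
      have hyd' := mem_perturb_domain.1 hyd
      rw [shift_perturb_apply _ hyd'] at hy
      obtain ⟨h2, h3⟩ := ih _ hy
      rw [inner_add_right, hshift, inner_smul_right, hvv, zero_add, mul_one] at h2
      rw [h2, zero_smul, add_zero] at h3
      exact ⟨h2, (mem_kerPow_succ _ _ _ _).2 ⟨hyd', h3⟩⟩
  have h2 : ∀ k y, y ∈ kerPow T μ k → y - inner ℂ v y • v ∈ kerPow (perturb T v v) μ k := by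
    intro k
    induction k with
    | zero =>
      intro y hy
      have hy0 : y = 0 := hy
      rw [hy0, inner_zero_right, zero_smul, sub_zero]
      exact Submodule.zero_mem _
    | succ k ih =>
      intro y hy
      obtain ⟨hyd, hy⟩ := (mem_kerPow_succ _ _ _ _).1 hy
      have h3 := ih _ hy
      rw [hshift, zero_smul, sub_zero] at h3
      have hd : y - inner ℂ v y • v ∈ T.domain :=
        T.domain.sub_mem hyd (T.domain.smul_mem _ hvd)
      refine (mem_kerPow_succ _ _ _ _).2 ⟨mem_perturb_domain.2 hd, ?_⟩
      rw [shift_perturb_apply _ hd]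
      have h4 : shift T μ ⟨y - inner ℂ v y • v, hd⟩ = shift T μ ⟨y, hyd⟩ := by
        have h5 : (⟨y - inner ℂ v y • v, hd⟩ : T.domain) =
            ⟨y, hyd⟩ - (inner ℂ v y : ℂ) • ⟨v, hvd⟩ := rfl
        have h6 : shift T μ ⟨v, hvd⟩ = 0 := by rw [shift_apply, hvT, sub_self]
        rw [h5, map_sub, map_smul, h6, smul_zero, sub_zero]
      rw [h4, inner_sub_right, inner_smul_right, hvv, mul_one, sub_self, zero_smul, add_zero]
      exact h3
  have hsup : rootSubspace T μ = rootSubspace (perturb T v v) μ ⊔ Submodule.span ℂ {v} := by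
    refine le_antisymm (fun y hy => ?_) (sup_le (fun y hy => ?_) ?_)
    · obtain ⟨k, hk⟩ := (mem_rootSubspace _ _ _).1 hy
      refine Submodule.mem_sup.2 ⟨_, (mem_rootSubspace _ _ _).2 ⟨k, h2 k y hk⟩,
        inner ℂ v y • v, Submodule.smul_mem _ _ (Submodule.mem_span_singleton_self v), ?_⟩
      exact sub_add_cancel _ _
    · obtain ⟨k, hk⟩ := (mem_rootSubspace _ _ _).1 hy
      exact (mem_rootSubspace _ _ _).2 ⟨k, (h1 k y hk).2⟩
    · rw [Submodule.span_singleton_le_iff_mem]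
      exact (mem_rootSubspace _ _ _).2 ⟨1, hv⟩
  have hinf : rootSubspace (perturb T v v) μ ⊓ Submodule.span ℂ {v} = ⊥ := by
    refine (Submodule.eq_bot_iff _).2 fun y hy => ?_
    obtain ⟨k, hk⟩ := (mem_rootSubspace _ _ _).1 hy.1
    obtain ⟨c, rfl⟩ := Submodule.mem_span_singleton.1 hy.2
    have := (h1 k _ hk).1
    rw [inner_smul_right, hvv, mul_one] at this
    rw [this, zero_smul]
  have hv0 : v ≠ 0 := by
    rintro rfl
    rw [norm_zero] at hv1
    exact zero_ne_one hv1
  rw [hsup]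
  refine ⟨inferInstance, ?_⟩
  have h3 := Submodule.finrank_sup_add_finrank_inf_eq (rootSubspace (perturb T v v) μ)
    (Submodule.span ℂ {v})
  rwa [hinf, finrank_bot, add_zero, finrank_span_singleton hv0] at h3

end Splitting

section Spectrum

variable {H : Type*} [NormedAddCommGroup H] [InnerProductSpace ℂ H] {ι : Type*}
  {A : H →ₗ.[ℂ] H} {b : HilbertBasis ι ℂ H} {lam : ι → ℝ} {d : ℝ} (hd : 0 < d)
  (hs : ∀ m n, m ≠ n → d ≤ |lam m - lam n|)
  (hA : IsDiagonal A b fun n => (lam n : ℂ))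

include hd hs hA

theorem exists_resolvent_apply (ψ : H) : ∃ y : ℂ → H, ∀ z, (∀ n, z ≠ (lam n : ℂ)) →
    ∃ h : y z ∈ A.domain, shift A z ⟨y z, h⟩ = ψ := by
  have h1 : ∀ z : ℂ, ∃ x : H, (∀ n, z ≠ (lam n : ℂ)) →
      ∃ h : x ∈ A.domain, shift A z ⟨x, h⟩ = ψ := by
    intro z
    by_cases hz : ∀ n, z ≠ (lam n : ℂ)
    · obtain ⟨δ, hδ, h⟩ := exists_pos_le_norm_sub hd hs z
      obtain ⟨R, hR, -⟩ := hA.mem_resolventSet hδ fun n => h n (hz n).symm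
      exact ⟨R ψ, fun _ => hR ψ⟩
    · exact ⟨0, fun h => absurd h hz⟩
  choose y hy using h1
  exact ⟨y, hy⟩

/-- After the eigenvalue `lam k` is moved to `lam k + 1`, the operator is invertible at `lam k`. -/
theorem exists_resolvent_perturb_basis (k : ι) : ∃ R : H →L[ℂ] H,
    (∀ y, ∃ h : R y ∈ (perturb A (b k) (b k)).domain,
      shift (perturb A (b k) (b k)) (lam k) ⟨R y, h⟩ = y) ∧
    (∀ x : (perturb A (b k) (b k)).domain, R (shift (perturb A (b k) (b k)) (lam k) x) = x) ∧
    R (b k) = b k ∧ ∀ y, inner ℂ (b k) (R y) = inner ℂ (b k) y := by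
  classical
  obtain ⟨δ, hδ, h⟩ := exists_pos_le_norm_sub hd hs (lam k : ℂ)
  have hA1 := hA.perturb_basis k
  obtain ⟨R, hR, hR'⟩ := hA1.mem_resolventSet (z := (lam k : ℂ)) (lt_min hδ one_pos) fun n => by
    rcases eq_or_ne n k with rfl | hn
    · rw [Function.update_self]
      simp
    · rw [Function.update_of_ne hn]
      exact (min_le_left _ _).trans
        (h n fun h' => hn (injective_of_separated hd hs (Complex.ofReal_injective h')))
  refine ⟨R, hR, hR', ?_, fun y => ?_⟩
  · have h1 := hR' ⟨b k, hA1.basis_mem_domain k⟩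
    rw [shift_apply, hA1.apply_basis k, Function.update_self, ← sub_smul, add_sub_cancel_left,
      one_smul] at h1
    exact h1
  · obtain ⟨h1, h2⟩ := hR y
    have h3 := congrArg (inner ℂ (b k)) h2
    rw [shift_apply, inner_sub_right, inner_smul_right, hA1.inner_apply, Function.update_self] at h3
    rw [← h3]
    ring

variable {ν : ι → ℂ} (hν : Summable fun n => ‖ν n - (lam n : ℂ)‖) {φ ψ : H}
  (hc : ∀ n, starRingEnd ℂ (inner ℂ (b n) φ) * inner ℂ (b n) ψ = resCoeff lam ν n)

include hν hc

theorem one_add_inner_eq_quotProd {z : ℂ} (hz : ∀ n, z ≠ (lam n : ℂ)) {y : H} (hy : y ∈ A.domain)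
    (h : shift A z ⟨y, hy⟩ = ψ) : 1 + inner ℂ φ y = quotProd lam ν z := by
  rw [quotProd_eq hd hs hν hz, ← b.tsum_inner_mul_inner φ y]
  congr 1
  refine tsum_congr fun n => ?_
  rw [hA.inner_eq_div hz hy h, ← hc n, inner_conj_symm, mul_div_assoc]

/-- At an eigenvalue `lam k` with `⟨b k, φ⟩ ≠ 0`, the operator `A + ⟨·, φ⟩ b k` is invertible,
and serves as the unperturbed operator. -/
theorem finrank_rootSubspace_of_left (k : ι) (hφ : inner ℂ φ (b k) ≠ 0) :
    Module.Finite ℂ (rootSubspace (perturb A φ ψ) (lam k)) ∧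
      Module.finrank ℂ (rootSubspace (perturb A φ ψ) (lam k)) = {n | ν n = lam k}.ncard ∧
      ({n | ν n = lam k}.ncard = 0 → (lam k : ℂ) ∈ resolventSet (perturb A φ ψ)) := by
  set α : ℂ := inner ℂ φ (b k) with hα
  obtain ⟨y, hy⟩ := exists_resolvent_apply hd hs hA ψ
  obtain ⟨R, hR, hR', hRk, hRi⟩ := exists_resolvent_perturb_basis hd hs hA k
  obtain ⟨δ, hδ, hle⟩ := exists_pos_le_norm_sub hd hs (lam k : ℂ)
  have hev := eventually_half_le_norm_sub hδ hle
  obtain ⟨h, l, hl, hlim, heq⟩ := exists_quotProd_mul_eq hd hs hν (lam k : ℂ) (K := {k}) fun n => by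
    rw [Finset.mem_singleton, Complex.ofReal_inj, (injective_of_separated hd hs).eq_iff]
  have hbb : inner ℂ (b k) (b k) = (1 : ℂ) := by
    rw [inner_self_eq_norm_sq_to_K, b.orthonormal.1 k]
    simp
  have hres : (lam k : ℂ) ∈ resolventSet (perturb A φ (b k)) := by
    have h1 : perturb A φ (b k) = perturb (perturb A (b k) (b k)) (φ - b k) (b k) := by
      rw [perturb_perturb_right, add_sub_cancel]
    rw [h1]
    refine mem_resolventSet_perturb hR hR' ?_
    rw [hRk, inner_sub_left, hbb, add_sub_cancel]
    exact hφ
  have hB : perturb A φ ψ = perturb (perturb A φ (b k)) φ (ψ - b k) := by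
    rw [perturb_perturb_left, add_sub_cancel]
  have hκ : Tendsto (fun z : ℂ => (lam k : ℂ) - z + α) (𝓝[≠] (lam k : ℂ)) (𝓝 α) := by
    have : Tendsto (fun z : ℂ => (lam k : ℂ) - z + α) (𝓝 (lam k : ℂ))
        (𝓝 ((lam k : ℂ) - lam k + α)) := (tendsto_id.const_sub _).add_const _
    rw [sub_self, zero_add] at this
    exact this.mono_left nhdsWithin_le_nhds
  have hκ0 := hκ.eventually_ne hφ
  rw [hB]
  refine finrank_rootSubspace_perturb hres
    (y := fun z => y z - (quotProd lam ν z / ((lam k : ℂ) - z + α)) • b k)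
    (h := fun z => h z / ((lam k : ℂ) - z + α)) (l := l / α) ?_ (div_ne_zero hl hφ)
    (hlim.div hκ hφ) ?_
  · filter_upwards [hev, hκ0] with z hz hz0
    obtain ⟨h1, h2⟩ := hy z hz.2.2.2
    have hF := one_add_inner_eq_quotProd hd hs hA hν hc hz.2.2.2 h1 h2
    have hbd := hA.basis_mem_domain k
    have h3 : y z - (quotProd lam ν z / ((lam k : ℂ) - z + α)) • b k ∈ A.domain :=
      A.domain.sub_mem h1 (A.domain.smul_mem _ hbd)
    refine ⟨mem_perturb_domain.2 h3, ?_⟩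
    have h4 : (⟨_, h3⟩ : A.domain) =
        ⟨y z, h1⟩ - (quotProd lam ν z / ((lam k : ℂ) - z + α)) • ⟨b k, hbd⟩ := rfl
    have h5 : shift A z ⟨b k, hbd⟩ = ((lam k : ℂ) - z) • b k := by
      rw [shift_apply, hA.apply_basis k, sub_smul]
    rw [shift_perturb_apply _ h3, h4, map_sub, map_smul, h2, h5, inner_sub_right,
      inner_smul_right, ← hα]
    have h6 : -(quotProd lam ν z / ((lam k : ℂ) - z + α) * ((lam k : ℂ) - z)) +
        (inner ℂ φ (y z) - quotProd lam ν z / ((lam k : ℂ) - z + α) * α) = -1 := by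
      rw [← hF]
      field_simp
      ring
    linear_combination (norm := module) h6 • b k
  · filter_upwards [hev, hκ0, heq] with z hz hz0 hz1
    obtain ⟨h1, h2⟩ := hy z hz.2.2.2
    have hF := one_add_inner_eq_quotProd hd hs hA hν hc hz.2.2.2 h1 h2
    rw [Finset.prod_singleton] at hz1
    rw [← mul_div_assoc, ← hz1, inner_sub_right, inner_smul_right, ← hα, ← hF]
    field_simp
    ring

/-- At an eigenvalue `lam k` with `⟨b k, ψ⟩ ≠ 0`, the operator `A + ⟨·, b k⟩ ψ` is invertible,
and serves as the unperturbed operator. -/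
theorem finrank_rootSubspace_of_right (k : ι) (hψ : inner ℂ (b k) ψ ≠ 0) :
    Module.Finite ℂ (rootSubspace (perturb A φ ψ) (lam k)) ∧
      Module.finrank ℂ (rootSubspace (perturb A φ ψ) (lam k)) = {n | ν n = lam k}.ncard ∧
      ({n | ν n = lam k}.ncard = 0 → (lam k : ℂ) ∈ resolventSet (perturb A φ ψ)) := by
  set β : ℂ := inner ℂ (b k) ψ with hβ
  obtain ⟨y, hy⟩ := exists_resolvent_apply hd hs hA ψ
  obtain ⟨R, hR, hR', hRk, hRi⟩ := exists_resolvent_perturb_basis hd hs hA k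
  obtain ⟨δ, hδ, hle⟩ := exists_pos_le_norm_sub hd hs (lam k : ℂ)
  have hev := eventually_half_le_norm_sub hδ hle
  obtain ⟨h, l, hl, hlim, heq⟩ := exists_quotProd_mul_eq hd hs hν (lam k : ℂ) (K := {k}) fun n => by
    rw [Finset.mem_singleton, Complex.ofReal_inj, (injective_of_separated hd hs).eq_iff]
  have hbb : inner ℂ (b k) (b k) = (1 : ℂ) := by
    rw [inner_self_eq_norm_sq_to_K, b.orthonormal.1 k]
    simp
  have hres : (lam k : ℂ) ∈ resolventSet (perturb A (b k) ψ) := by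
    have h1 : perturb A (b k) ψ = perturb (perturb A (b k) (b k)) (b k) (ψ - b k) := by
      rw [perturb_perturb_left, add_sub_cancel]
    rw [h1]
    refine mem_resolventSet_perturb hR hR' ?_
    rw [hRi, inner_sub_right, hbb, add_sub_cancel]
    exact hψ
  have hB : perturb A φ ψ = perturb (perturb A (b k) ψ) (φ - b k) ψ := by
    rw [perturb_perturb_right, add_sub_cancel]
  have hκ : Tendsto (fun z : ℂ => (lam k : ℂ) - z + β) (𝓝[≠] (lam k : ℂ)) (𝓝 β) := by
    have : Tendsto (fun z : ℂ => (lam k : ℂ) - z + β) (𝓝 (lam k : ℂ))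
        (𝓝 ((lam k : ℂ) - lam k + β)) := (tendsto_id.const_sub _).add_const _
    rw [sub_self, zero_add] at this
    exact this.mono_left nhdsWithin_le_nhds
  have hκ0 := hκ.eventually_ne hψ
  rw [hB]
  refine finrank_rootSubspace_perturb hres
    (y := fun z => (((lam k : ℂ) - z) / ((lam k : ℂ) - z + β)) • y z)
    (h := fun z => h z / ((lam k : ℂ) - z + β)) (l := l / β) ?_ (div_ne_zero hl hψ)
    (hlim.div hκ hψ) ?_
  · filter_upwards [hev, hκ0] with z hz hz0
    obtain ⟨h1, h2⟩ := hy z hz.2.2.2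
    have hk0 : (lam k : ℂ) - z ≠ 0 := sub_ne_zero.2 (hz.2.2.2 k).symm
    have h3 : (((lam k : ℂ) - z) / ((lam k : ℂ) - z + β)) • y z ∈ A.domain :=
      A.domain.smul_mem _ h1
    refine ⟨mem_perturb_domain.2 h3, ?_⟩
    have h4 : (⟨_, h3⟩ : A.domain) =
        (((lam k : ℂ) - z) / ((lam k : ℂ) - z + β)) • ⟨y z, h1⟩ := rfl
    rw [shift_perturb_apply _ h3, h4, map_smul, h2, inner_smul_right,
      hA.inner_eq_div hz.2.2.2 h1 h2, ← hβ]
    have h6 : ((lam k : ℂ) - z) / ((lam k : ℂ) - z + β) +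
        ((lam k : ℂ) - z) / ((lam k : ℂ) - z + β) * (β / ((lam k : ℂ) - z)) = 1 := by
      field_simp
    linear_combination (norm := module) h6 • ψ
  · filter_upwards [hev, hκ0, heq] with z hz hz0 hz1
    obtain ⟨h1, h2⟩ := hy z hz.2.2.2
    have hF := one_add_inner_eq_quotProd hd hs hA hν hc hz.2.2.2 h1 h2
    have hk0 : (lam k : ℂ) - z ≠ 0 := sub_ne_zero.2 (hz.2.2.2 k).symm
    rw [Finset.prod_singleton] at hz1
    rw [← mul_div_assoc, ← hz1, inner_smul_right, inner_sub_left,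
      hA.inner_eq_div hz.2.2.2 h1 h2, ← hβ, ← hF]
    field_simp
    ring

/-- At an eigenvalue `lam k` with `⟨b k, φ⟩ = ⟨b k, ψ⟩ = 0`, the eigenvector `b k` splits off, and
the operator with `lam k` moved to `lam k + 1` serves as the unperturbed operator. -/
theorem finrank_rootSubspace_of_eq_zero (k : ι) (hφ : inner ℂ φ (b k) = 0)
    (hψ : inner ℂ (b k) ψ = 0) :
    Module.Finite ℂ (rootSubspace (perturb A φ ψ) (lam k)) ∧
      Module.finrank ℂ (rootSubspace (perturb A φ ψ) (lam k)) = {n | ν n = lam k}.ncard ∧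
      {n | ν n = lam k}.ncard ≠ 0 := by
  obtain ⟨y, hy⟩ := exists_resolvent_apply hd hs hA ψ
  obtain ⟨R, hR, hR', -, -⟩ := exists_resolvent_perturb_basis hd hs hA k
  obtain ⟨δ, hδ, hle⟩ := exists_pos_le_norm_sub hd hs (lam k : ℂ)
  have hev := eventually_half_le_norm_sub hδ hle
  obtain ⟨h, l, hl, hlim, heq⟩ := exists_quotProd_mul_eq hd hs hν (lam k : ℂ) (K := {k}) fun n => by
    rw [Finset.mem_singleton, Complex.ofReal_inj, (injective_of_separated hd hs).eq_iff]
  simp only [Finset.prod_singleton] at heq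
  have hck : resCoeff lam ν k = 0 := by rw [← hc k, hψ, mul_zero]
  have hN : {n | ν n = lam k}.ncard ≠ 0 := by
    intro hN
    rw [hN] at heq
    have h1 := (tendsto_mul_quotProd hd hs hν k).neg
    rw [hck, neg_zero, neg_zero] at h1
    refine hl (tendsto_nhds_unique hlim (h1.congr' ?_))
    filter_upwards [heq] with z hz
    rw [pow_zero, one_mul] at hz
    rw [← hz]
    ring
  obtain ⟨N, hN'⟩ := Nat.exists_eq_succ_of_ne_zero hN
  rw [hN'] at heq
  obtain ⟨h1, h2, -⟩ := finrank_rootSubspace_perturb (A := perturb A (b k) (b k)) ⟨R, hR, hR'⟩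
    (φ := φ) (ψ := ψ) (y := y) (h := fun z => -h z) (l := -l) (p := N) (by
      filter_upwards [hev] with z hz
      obtain ⟨h1, h2⟩ := hy z hz.2.2.2
      refine ⟨mem_perturb_domain.2 h1, ?_⟩
      rw [shift_perturb_apply _ h1, h2, hA.inner_eq_div hz.2.2.2 h1 h2, hψ, zero_div, zero_smul,
        add_zero]) (neg_ne_zero.2 hl) hlim.neg (by
      filter_upwards [hev, heq] with z hz hz1
      obtain ⟨h1, h2⟩ := hy z hz.2.2.2
      have hk0 : (lam k : ℂ) - z ≠ 0 := sub_ne_zero.2 (hz.2.2.2 k).symm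
      rw [one_add_inner_eq_quotProd hd hs hA hν hc hz.2.2.2 h1 h2]
      refine mul_right_cancel₀ hk0 ?_
      rw [hz1, pow_succ]
      ring)
  rw [perturb_comm] at h1 h2
  have hbd := hA.basis_mem_domain k
  obtain ⟨h3, h4⟩ := finrank_rootSubspace_eq_succ (T := perturb A φ ψ) (b.orthonormal.1 k)
    ((mem_eigenspace _ _ _).2 ⟨mem_perturb_domain.2 hbd, by
      have : (perturb A φ ψ) ⟨b k, mem_perturb_domain.2 hbd⟩ =
        A ⟨b k, hbd⟩ + inner ℂ φ (b k) • ψ := rfl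
      rw [this, hφ, zero_smul, add_zero, hA.apply_basis k]⟩) (fun x => by
      have : (perturb A φ ψ) x =
        A ⟨x, mem_perturb_domain.1 x.2⟩ + inner ℂ φ (x : H) • ψ := rfl
      rw [this, inner_add_right, inner_smul_right, hψ, mul_zero, add_zero, hA.inner_apply]) h1
  exact ⟨h3, by rw [h4, h2, hN'], hN⟩

theorem finrank_rootSubspace_perturb_diagonal (μ : ℂ) :
    Module.Finite ℂ (rootSubspace (perturb A φ ψ) μ) ∧
      Module.finrank ℂ (rootSubspace (perturb A φ ψ) μ) = {n | ν n = μ}.ncard ∧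
      ({n | ν n = μ}.ncard = 0 → μ ∈ resolventSet (perturb A φ ψ)) := by
  by_cases hμ : ∃ k, (lam k : ℂ) = μ
  · obtain ⟨k, rfl⟩ := hμ
    by_cases hφ : inner ℂ φ (b k) = 0
    · by_cases hψ : inner ℂ (b k) ψ = 0
      · obtain ⟨h1, h2, h3⟩ := finrank_rootSubspace_of_eq_zero hd hs hA hν hc k hφ hψ
        exact ⟨h1, h2, fun h => absurd h h3⟩
      · exact finrank_rootSubspace_of_right hd hs hA hν hc k hψ
    · exact finrank_rootSubspace_of_left hd hs hA hν hc k hφ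
  · push Not at hμ
    obtain ⟨y, hy⟩ := exists_resolvent_apply hd hs hA ψ
    obtain ⟨δ, hδ, hle⟩ := exists_pos_le_norm_sub hd hs μ
    have hev := eventually_half_le_norm_sub hδ hle
    obtain ⟨h, l, hl, hlim, heq⟩ := exists_quotProd_mul_eq hd hs hν μ (K := ∅) fun n => by
      simpa using hμ n
    refine finrank_rootSubspace_perturb (hA.mem_resolventSet hδ fun n => hle n (hμ n))
      (y := y) ?_ hl hlim ?_
    · filter_upwards [hev] with z hz using hy z hz.2.2.2
    · filter_upwards [hev, heq] with z hz hz1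
      obtain ⟨h1, h2⟩ := hy z hz.2.2.2
      rw [one_add_inner_eq_quotProd hd hs hA hν hc hz.2.2.2 h1 h2, ← hz1, Finset.prod_empty,
        mul_one]

theorem spectrumIs_perturb : SpectrumIs (perturb A φ ψ) ν := by
  refine ⟨Set.ext fun z => ⟨fun hz => ?_, ?_⟩, fun z => ?_⟩
  · by_contra h
    refine hz ((finrank_rootSubspace_perturb_diagonal hd hs hA hν hc z).2.2 ?_)
    rw [Set.ncard_eq_zero (finite_fiber hd hs hν z)]
    refine Set.eq_empty_iff_forall_notMem.2 fun n hn => h ⟨n, hn⟩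
  · rintro ⟨n, rfl⟩ hz
    have h1 := (finrank_rootSubspace_perturb_diagonal hd hs hA hν hc (ν n)).2.1
    rw [rootSubspace_eq_bot_of_mem_resolventSet hz, finrank_bot, eq_comm,
      Set.ncard_eq_zero (finite_fiber hd hs hν (ν n))] at h1
    exact Set.eq_empty_iff_forall_notMem.1 h1 n rfl
  · obtain ⟨h1, h2, -⟩ := finrank_rootSubspace_perturb_diagonal hd hs hA hν hc z
    exact ⟨finite_fiber hd hs hν z, h1, h2⟩

end Spectrum

/-! ### Vectors with prescribed products of coefficients -/

section Existence

variable {H : Type*} [NormedAddCommGroup H] [InnerProductSpace ℂ H] {ι : Type*}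

theorem exists_coeff_eq (b : HilbertBasis ι ℂ H) {u : ι → ℂ} (hu : Summable fun n => ‖u n‖ ^ 2) :
    ∃ x : H, ∀ n, inner ℂ (b n) x = u n := by
  have hmem : Memℓp u 2 := memℓp_gen (by simpa using hu)
  refine ⟨b.repr.symm ⟨u, hmem⟩, fun n => ?_⟩
  rw [← b.repr_apply_apply, LinearIsometryEquiv.apply_symm_apply]

/-- A summable sequence is the product of two square summable ones. If it vanishes identically, the
vectors are taken as two different basis vectors. -/
theorem exists_ne_zero_coeff_mul_eq (hH : ¬ FiniteDimensional ℂ H) (b : HilbertBasis ι ℂ H)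
    {c : ι → ℂ} (hc : Summable fun n => ‖c n‖) :
    ∃ φ ψ : H, φ ≠ 0 ∧ ψ ≠ 0 ∧
      ∀ n, starRingEnd ℂ (inner ℂ (b n) φ) * inner ℂ (b n) ψ = c n := by
  classical
  by_cases h0 : ∀ n, c n = 0
  · have hinf : Infinite ι := by
      by_contra hfin
      rw [not_infinite_iff_finite] at hfin
      have := Fintype.ofFinite ι
      exact hH b.toOrthonormalBasis.toBasis.finiteDimensional_of_finite
    obtain ⟨i, j, hij⟩ := exists_pair_ne ι
    refine ⟨b i, b j, b.orthonormal.ne_zero i, b.orthonormal.ne_zero j, fun n => ?_⟩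
    rw [orthonormal_iff_ite.1 b.orthonormal, orthonormal_iff_ite.1 b.orthonormal, h0 n]
    rcases eq_or_ne n i with rfl | hn
    · rw [if_neg hij, mul_zero]
    · rw [if_neg hn, map_zero, zero_mul]
  · push Not at h0
    obtain ⟨k, hk⟩ := h0
    have hsq : ∀ n, ‖((√‖c n‖ : ℝ) : ℂ)‖ ^ 2 = ‖c n‖ := fun n => by
      rw [Complex.norm_real, Real.norm_eq_abs, sq_abs, Real.sq_sqrt (norm_nonneg _)]
    have hsq' : ∀ n, ‖c n / ((√‖c n‖ : ℝ) : ℂ)‖ ^ 2 = ‖c n‖ := fun n => by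
      rw [norm_div, div_pow, hsq]
      by_cases h : ‖c n‖ = 0
      · rw [h]; simp
      · field_simp
    obtain ⟨φ, hφ⟩ := exists_coeff_eq b (u := fun n => ((√‖c n‖ : ℝ) : ℂ))
      (by simpa only [hsq] using hc)
    obtain ⟨ψ, hψ⟩ := exists_coeff_eq b (u := fun n => c n / ((√‖c n‖ : ℝ) : ℂ))
      (by simpa only [hsq'] using hc)
    have hmul : ∀ n, starRingEnd ℂ (inner ℂ (b n) φ) * inner ℂ (b n) ψ = c n := by
      intro n
      rw [hφ, hψ, Complex.conj_ofReal]
      by_cases h : c n = 0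
      · simp [h]
      · have : ((√‖c n‖ : ℝ) : ℂ) ≠ 0 := by
          rw [Complex.ofReal_ne_zero, Real.sqrt_ne_zero']
          exact norm_pos_iff.2 h
        field_simp
    refine ⟨φ, ψ, ?_, ?_, hmul⟩
    · rintro rfl
      exact hk (by rw [← hmul k, inner_zero_right, map_zero, zero_mul])
    · rintro rfl
      exact hk (by rw [← hmul k, inner_zero_right, mul_zero])

end Existence

end RankOne

theorem theorem4p1 {H : Type*} [NormedAddCommGroup H] [InnerProductSpace ℂ H] [CompleteSpace H]
    (hH : ¬ FiniteDimensional ℂ H) {ι : Type*}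
    (A : H →ₗ.[ℂ] H) (lam : ι → ℝ) (hA : RankOne.HasSimpleSeparatedSpectrum A lam)
    (v : ι → H) (hv : ∀ n, v n ∈ RankOne.eigenspace A (lam n)) (hv1 : ∀ n, ‖v n‖ = 1)
    (ν : ι → ℂ) (hν : Summable fun n => ‖ν n - (lam n : ℂ)‖) :
    -- existence of a rank-one perturbation with spectrum `ν`
    (∃ φ ψ : H, φ ≠ 0 ∧ ψ ≠ 0 ∧ RankOne.SpectrumIs (RankOne.perturb A φ ψ) ν) ∧
    -- the infinite product converges
    (∀ z : ℂ, (∀ n, z ≠ (lam n : ℂ)) →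
      Multipliable fun n => (ν n - z) / ((lam n : ℂ) - z)) ∧
    -- it has residues `-c n`, and these produce the perturbations
    ∃ c : ι → ℂ,
      (∀ n, Tendsto (fun z : ℂ => (z - (lam n : ℂ)) * RankOne.quotProd lam ν z)
        (𝓝[≠] (lam n : ℂ)) (𝓝 (-c n))) ∧
      (∃ φ ψ : H, φ ≠ 0 ∧ ψ ≠ 0 ∧
        ∀ n, starRingEnd ℂ (RankOne.coeff v φ n) * RankOne.coeff v ψ n = c n) ∧
      ∀ φ ψ : H,
        (∀ n, starRingEnd ℂ (RankOne.coeff v φ n) * RankOne.coeff v ψ n = c n) →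
          RankOne.SpectrumIs (RankOne.perturb A φ ψ) ν := by
  obtain ⟨d, hd, hs⟩ := hA.separated
  obtain ⟨b, rfl, hAb⟩ := RankOne.exists_hilbertBasis_isDiagonal hA hv hv1
  obtain ⟨φ, ψ, hφ, hψ, hc⟩ := RankOne.exists_ne_zero_coeff_mul_eq hH b
    (RankOne.summable_norm_resCoeff hd hs hν)
  exact ⟨⟨φ, ψ, hφ, hψ, RankOne.spectrumIs_perturb hd hs hAb hν hc⟩,
    fun z hz => RankOne.multipliable_quot hd hs hν hz,
    RankOne.resCoeff lam ν, RankOne.tendsto_mul_quotProd hd hs hν, ⟨φ, ψ, hφ, hψ, hc⟩,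
    fun φ ψ hc => RankOne.spectrumIs_perturb hd hs hAb hν hc⟩
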